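/- Let $X$ be a topological space. A point $p\in X$ is a condensation point of $A\subseteq X$ if every neighbourhood of $p$ contains uncountably many points of $A$; let $CD(A)$ be the set of all condensation points of $A$. Put $CD^0(A)=A$, $CD^{\alpha+1}(A)=CD(CD^\alpha(A))$ and $CD^\alpha(A)=\bigcap_{0<\beta<\alpha}CD^\beta(A)$ for limit ordinals $\alpha$; let $\alpha_A$ be the least ordinal $\alpha_0$ such that $CD^\alpha(A)=CD^{\alpha_0}(A)$ for all $\alpha\ge\alpha_0$ (such an ordinal exists). The condensation rank of $X$ is the ordinal $CR(X)=\sup\{\alpha_A : A\subseteq X\}$; for a subset $A$ of a topological space, $CR(A)$ is the condensation rank of $A$ with the subspace topology. A set is totally imperfect if it contains no nonempty perfect set (a perfect set being a closed set without isolated points). A real or complex Banach space $X$ is injective if for every Banach space $Y$ over the same scalars and every closed subspace $Z\subseteq Y$, every bounded linear operator $Z\to X$ extends to a bounded linear operator $Y\to X$. Theorem. Let $X$ be an infinite-dimensional injective (real or complex) Banach space, and let $\Omega_1$ be the first uncountable ordinal. Then $CR(X)\ge\Omega_1$. In addition, $$\{CR(A) : A\subseteq X,\ A \text{ a totally imperfect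 closed set}\}\supseteq[1,\Omega_1].$$ -/

import Mathlib

open Set Topology Ordinal

universe u v

/-- `p` is a condensation point of `A`: every neighbourhood of `p` contains uncountably many
points of `A`. -/
def IsCondensationPoint {X : Type u} [TopologicalSpace X] (p : X) (A : Set X) : Prop :=
  ∀ U ∈ 𝓝 p, ¬ (U ∩ A).Countable

/-- The condensation derived set `CD(A)`: the set of all condensation points of `A`. -/
def condDeriv {X : Type u} [TopologicalSpace X] (A : Set X) : Set X :=
  {p | IsCondensationPoint p A}

/-- The iterated condensation derivative: `CD^0(A) = A`, `CD^(α+1)(A) = CD(CD^α(A))`, and at a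
limit ordinal `α` the intersection of the `CD^β(A)` with `0 < β < α`. For closed `A` the term
`β = 0` would change nothing; for a general `A` the sets `CD^β(A)` decrease only from `β = 1` on,
and the term `β = 0` has to be left out for the iteration to become stationary. -/
noncomputable def iterCondDeriv {X : Type u} [TopologicalSpace X] (A : Set X)
    (α : Ordinal.{u}) : Set X :=
  Ordinal.limitRecOn (motive := fun _ => Set X) α A (fun _ S => condDeriv S)
    (fun α _ ih => ⋂ (β : Ordinal.{u}) (h : β < α) (_ : 0 < β), ih β h)

/-- `α_A`: the least ordinal from which on the iterated condensation derivatives of `A` are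
constant (it exists, by `exists_stable_iterCondDeriv` below). -/
noncomputable def condIndex {X : Type u} [TopologicalSpace X] (A : Set X) : Ordinal.{u} :=
  sInf {α₀ : Ordinal.{u} | ∀ α, α₀ ≤ α → iterCondDeriv A α = iterCondDeriv A α₀}

/-- The condensation rank of a topological space: `CR(X) = sup {α_A | A ⊆ X}` (a supremum of a
small, hence bounded, family of ordinals). -/
noncomputable def condRank (X : Type u) [TopologicalSpace X] : Ordinal.{u} :=
  ⨆ A : Set X, condIndex A

/-- A set is totally imperfect if it contains no nonempty perfect set. -/
def IsTotallyImperfect {X : Type u} [TopologicalSpace X] (A : Set X) : Prop :=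
  ∀ P : Set X, P ⊆ A → Perfect P → P = ∅

/-- Injective Banach spaces: every bounded operator into `X` from a closed subspace of a Banach
space extends to a bounded operator on the whole space. -/
def IsInjectiveBanach (𝕜 : Type v) [RCLike 𝕜] (X : Type u) [NormedAddCommGroup X]
    [NormedSpace 𝕜 X] : Prop :=
  ∀ (Y : Type u) [NormedAddCommGroup Y] [NormedSpace 𝕜 Y] [CompleteSpace Y]
    (Z : Submodule 𝕜 Y), IsClosed (Z : Set Y) →
    ∀ T : Z →L[𝕜] X, ∃ T' : Y →L[𝕜] X, ∀ z : Z, T' (z : Y) = T z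

theorem iterCondDeriv_zero {X : Type u} [TopologicalSpace X] (A : Set X) :
    iterCondDeriv A 0 = A := by
  simp [iterCondDeriv]

theorem iterCondDeriv_succ {X : Type u} [TopologicalSpace X] (A : Set X) (α : Ordinal.{u}) :
    iterCondDeriv A (Order.succ α) = condDeriv (iterCondDeriv A α) := by
  unfold iterCondDeriv
  rw [Order.succ_eq_add_one, Ordinal.limitRecOn_add_one]

theorem iterCondDeriv_limit {X : Type u} [TopologicalSpace X] (A : Set X) (α : Ordinal.{u})
    (hα : Order.IsSuccLimit α) :
    iterCondDeriv A α = ⋂ (β : Ordinal.{u}) (_ : β < α) (_ : 0 < β), iterCondDeriv A β := by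
  unfold iterCondDeriv
  rw [Ordinal.limitRecOn_limit _ _ _ _ hα]

theorem isClosed_condDeriv {X : Type u} [TopologicalSpace X] (A : Set X) :
    IsClosed (condDeriv A) := by
  rw [← isOpen_compl_iff, isOpen_iff_mem_nhds]
  intro p hp
  have h : ∃ U ∈ 𝓝 p, (U ∩ A).Countable := by
    by_contra hc
    push Not at hc
    exact hp hc
  obtain ⟨U, hU, hc⟩ := h
  filter_upwards [eventually_mem_nhds_iff.2 hU] with q hq hq'
  exact hq' U hq hc

theorem condDeriv_subset {X : Type u} [TopologicalSpace X] {A : Set X} (hA : IsClosed A) :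
    condDeriv A ⊆ A := by
  intro p hp
  by_contra hn
  apply hp Aᶜ (hA.isOpen_compl.mem_nhds hn)
  simp

theorem isClosed_iterCondDeriv {X : Type u} [TopologicalSpace X] (A : Set X) (α : Ordinal.{u})
    (hα : 0 < α) : IsClosed (iterCondDeriv A α) := by
  induction α using Ordinal.limitRecOn with
  | zero => exact absurd hα (lt_irrefl _)
  | add_one β _ => rw [← Order.succ_eq_add_one, iterCondDeriv_succ]; exact isClosed_condDeriv _
  | limit α h ih =>
    rw [iterCondDeriv_limit A α h]
    exact isClosed_iInter fun β => isClosed_iInter fun hβ => isClosed_iInter fun h0 => ih β hβ h0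

theorem iterCondDeriv_anti {X : Type u} [TopologicalSpace X] (A : Set X) {α β : Ordinal.{u}}
    (hα : 0 < α) (h : α ≤ β) : iterCondDeriv A β ⊆ iterCondDeriv A α := by
  induction β using Ordinal.limitRecOn with
  | zero => exact absurd (hα.trans_le h) (lt_irrefl _)
  | add_one β ih =>
    rcases h.eq_or_lt with rfl | h
    · exact subset_rfl
    · have hle : α ≤ β := Order.lt_add_one_iff.1 h
      rw [← Order.succ_eq_add_one, iterCondDeriv_succ]
      exact (condDeriv_subset (isClosed_iterCondDeriv A β (hα.trans_le hle))).trans (ih hle)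
  | limit β hl ih =>
    rcases h.eq_or_lt with rfl | h
    · exact subset_rfl
    · rw [iterCondDeriv_limit A β hl]
      exact iInter_subset_of_subset α (iInter_subset_of_subset h (iInter_subset _ hα))

theorem exists_stable_iterCondDeriv {X : Type u} [TopologicalSpace X] (A : Set X) :
    ∃ α₀ : Ordinal.{u}, ∀ α, α₀ ≤ α → iterCondDeriv A α = iterCondDeriv A α₀ := by
  -- the values at positive ordinals form a small set, so some choice of indices is bounded
  let g : {α : Ordinal.{u} // 0 < α} → Set X := fun α => iterCondDeriv A α.1
  let f : range g → Ordinal.{u} := fun S => S.2.choose.1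
  obtain ⟨γ, hγ⟩ := Ordinal.bddAbove_of_small (s := range f)
  have hpos : 0 < max γ 1 := lt_max_of_lt_right zero_lt_one
  refine ⟨max γ 1, fun α h => Subset.antisymm (iterCondDeriv_anti A hpos h) ?_⟩
  let S : range g := ⟨g ⟨α, hpos.trans_le h⟩, mem_range_self _⟩
  have h1 : f S ≤ γ := hγ (mem_range_self S)
  have h2 : iterCondDeriv A (f S) = iterCondDeriv A α := S.2.choose_spec
  rw [← h2]
  exact iterCondDeriv_anti A S.2.choose.2 (h1.trans (le_max_left _ _))

theorem iterCondDeriv_eq_of_condIndex_le {X : Type u} [TopologicalSpace X] (A : Set X)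
    {α : Ordinal.{u}} (h : condIndex A ≤ α) :
    iterCondDeriv A α = iterCondDeriv A (condIndex A) :=
  csInf_mem (s := {α₀ : Ordinal.{u} | ∀ α, α₀ ≤ α → iterCondDeriv A α = iterCondDeriv A α₀})
    (exists_stable_iterCondDeriv A) α h

theorem condIndex_le_condRank {X : Type u} [TopologicalSpace X] (A : Set X) :
    condIndex A ≤ condRank X :=
  Ordinal.le_iSup (fun A : Set X => condIndex A) A

/-!
An infinite-dimensional injective Banach space `X` is nonseparable, and in a nonseparable normed
space sets of every rank up to `ω₁` can be built by hand.

*Sets of prescribed rank.* In a nonseparable normed space every ball of radius `r` contains an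
uncountable set whose points have mutual distance at least `c * r`, with `c` independent of the
ball. By recursion on `α < ω₁` every ball contains a closed totally imperfect set `A` with its
centre `p` in `CD^α(A)` and `CD^(α+1)(A) = ∅`: on spheres shrinking to `p` put uncountably many such
sets for ordinals `β < α`, each `β` occurring on infinitely many spheres, in much smaller balls. The
centres of the pieces for `β` make `p` a condensation point of `CD^β(A)`, and away from `p` the set
is locally one of the pieces. For `1 ≤ γ ≤ ω₁`, a uniformly separated union of such pieces, one for
each `β < γ`, has `γ` as the first ordinal with empty derivative, so that its rank, and its index as
a subset of `X`, is `γ` (`exists_iterCondDeriv_eq_empty`, `condRank_eq`, `condIndex_eq`).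

*Nonseparability.* A separable injective `X` is a real-linear retract of the space of bounded real
functions on a countable set, by some `j : X → ℓ^∞` and `Q : ℓ^∞ → X`. Rosenthal's lemma shows that
the moduli `|d ∘ Q|` of the functionals `d ∘ Q` with `‖d‖ ≤ 1` are uniformly exhaustive
(`uniformlyExhaustive_modulus`), hence, as in the proof of the existence of control measures, small
on every set on which finitely many of them are small
(`UniformlyExhaustive.exists_finset_control`). If `φ` is the sum of these finitely many moduli, then
`‖x‖² ≤ K φ((j x)²)` on `X`, because a unit vector small outside a `φ`-small set would be mapped by
`Q ∘ j = id` to a vector of norm less than one. So the uniform norm is dominated by an `L²`-seminorm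
on `j X`, and Grothendieck's argument bounds the dimension (`finiteDimensional_of_sq_le`).
-/

/-! ### Iterated condensation derivatives -/

theorem condDeriv_inter_subset {X : Type u} [TopologicalSpace X] {A B U : Set X} (hU : IsOpen U)
    (h : U ∩ A ⊆ B) : U ∩ condDeriv A ⊆ condDeriv B := by
  rintro q ⟨hqU, hq⟩ V hV hc
  exact hq (V ∩ U) (Filter.inter_mem hV (hU.mem_nhds hqU))
    (hc.mono fun x (hx : x ∈ V ∩ U ∩ A) => show x ∈ V ∩ B from ⟨hx.1.1, h ⟨hx.1.2, hx.2⟩⟩)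

theorem condDeriv_eq_empty_of_countable {X : Type u} [TopologicalSpace X] {A : Set X}
    (hA : A.Countable) : condDeriv A = ∅ :=
  eq_empty_of_forall_notMem fun _ hq => hq univ Filter.univ_mem (hA.mono inter_subset_right)

/-- Iterated condensation derivatives are local. -/
theorem iterCondDeriv_inter_subset {X : Type u} [TopologicalSpace X] {A B U : Set X}
    (hU : IsOpen U) (h : U ∩ A ⊆ B) (α : Ordinal.{u}) :
    U ∩ iterCondDeriv A α ⊆ iterCondDeriv B α := by
  induction α using Ordinal.limitRecOn with
  | zero => simpa only [iterCondDeriv_zero] using h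
  | add_one β ih =>
    rw [← Order.succ_eq_add_one, iterCondDeriv_succ, iterCondDeriv_succ]
    exact condDeriv_inter_subset hU ih
  | limit α hl ih =>
    rw [iterCondDeriv_limit A α hl, iterCondDeriv_limit B α hl]
    rintro q ⟨hqU, hq⟩
    simp only [mem_iInter] at hq ⊢
    exact fun β hβ h0 => ih β hβ ⟨hqU, hq β hβ h0⟩

theorem iterCondDeriv_mono {X : Type u} [TopologicalSpace X] {A B : Set X} (h : A ⊆ B)
    (α : Ordinal.{u}) : iterCondDeriv A α ⊆ iterCondDeriv B α := by
  simpa only [univ_inter] using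
    iterCondDeriv_inter_subset isOpen_univ ((univ_inter A).symm ▸ h) α

theorem iterCondDeriv_subset {X : Type u} [TopologicalSpace X] {A : Set X} (hA : IsClosed A)
    (α : Ordinal.{u}) : iterCondDeriv A α ⊆ A := by
  rcases eq_or_ne α 0 with rfl | h
  · rw [iterCondDeriv_zero]
  · refine (iterCondDeriv_anti A zero_lt_one (Order.one_le_iff_ne_zero.2 h)).trans ?_
    rw [← zero_add (1 : Ordinal), ← Order.succ_eq_add_one, iterCondDeriv_succ, iterCondDeriv_zero]
    exact condDeriv_subset hA

theorem iterCondDeriv_univ_subtype {X : Type u} [TopologicalSpace X] {A : Set X} (hA : IsClosed A)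
    (α : Ordinal.{u}) :
    iterCondDeriv (univ : Set A) α = Subtype.val ⁻¹' iterCondDeriv A α := by
  induction α using Ordinal.limitRecOn with
  | zero => simp [iterCondDeriv_zero]
  | add_one β ih =>
    rw [← Order.succ_eq_add_one, iterCondDeriv_succ, iterCondDeriv_succ, ih]
    -- passing to the subspace loses no points, as the derivatives of a closed set lie in it
    have key : ∀ V : Set X, (Subtype.val ⁻¹' V ∩ Subtype.val ⁻¹' iterCondDeriv A β : Set A).Countable
        ↔ (V ∩ iterCondDeriv A β).Countable := fun V => by
      rw [← preimage_inter, ← Set.countable_coe_iff, ← Set.countable_coe_iff]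
      have hsub : V ∩ iterCondDeriv A β ⊆ range (Subtype.val : A → X) := by
        rw [Subtype.range_coe]
        exact inter_subset_right.trans (iterCondDeriv_subset hA β)
      rw [Set.countable_coe_iff, Set.countable_coe_iff]
      constructor
      · intro h
        have := h.image (Subtype.val : A → X)
        rwa [image_preimage_eq_of_subset hsub] at this
      · exact fun h => h.preimage Subtype.val_injective
    ext q
    constructor
    · intro hq V hV hc
      exact hq _ (continuous_subtype_val.continuousAt.preimage_mem_nhds hV) ((key V).2 hc)
    · intro hq U hU hc
      obtain ⟨V, hV, hVU⟩ := mem_nhds_subtype A q U |>.1 hU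
      exact hq V hV ((key V).1 (hc.mono (inter_subset_inter_left _ hVU)))
  | limit α hl ih =>
    rw [iterCondDeriv_limit _ α hl, iterCondDeriv_limit _ α hl]
    simp only [preimage_iInter]
    exact iInter_congr fun β => iInter_congr fun hβ => iInter_congr fun _ => ih β hβ

/-- If `γ > 0` is the first ordinal at which the iterated derivative is empty, then `γ` is the
index of the set. -/
theorem condIndex_eq {X : Type u} [TopologicalSpace X] {A : Set X} {γ : Ordinal.{u}} (h0 : 0 < γ)
    (h : iterCondDeriv A γ = ∅) (hne : ∀ β < γ, (iterCondDeriv A β).Nonempty) :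
    condIndex A = γ := by
  have hle : condIndex A ≤ γ := csInf_le' fun α hα => by
    rw [h]; exact subset_empty_iff.1 (h ▸ iterCondDeriv_anti A h0 hα)
  refine hle.antisymm (not_lt.1 fun hlt => ?_)
  have := hne _ hlt
  rw [← iterCondDeriv_eq_of_condIndex_le A hle, h] at this
  exact not_nonempty_empty this

theorem condRank_eq {X : Type u} [TopologicalSpace X] {A : Set X} (hA : IsClosed A)
    {γ : Ordinal.{u}} (h0 : 0 < γ)
    (h : iterCondDeriv A γ = ∅) (hne : ∀ β < γ, (iterCondDeriv A β).Nonempty) :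
    condRank A = γ := by
  have hu : iterCondDeriv (univ : Set A) γ = ∅ := by
    rw [iterCondDeriv_univ_subtype hA, h, preimage_empty]
  have hidx : condIndex (univ : Set A) = γ := condIndex_eq h0 hu fun β hβ => by
    obtain ⟨q, hq⟩ := hne β hβ
    rw [iterCondDeriv_univ_subtype hA]
    exact ⟨⟨q, iterCondDeriv_subset hA β hq⟩, hq⟩
  refine le_antisymm (Ordinal.iSup_le fun S => ?_) (hidx ▸ condIndex_le_condRank _)
  have hS : iterCondDeriv S γ = ∅ :=
    subset_empty_iff.1 (hu ▸ iterCondDeriv_mono (subset_univ S) γ)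
  exact csInf_le' fun α hα => by
    rw [hS]; exact subset_empty_iff.1 (hS ▸ iterCondDeriv_anti S h0 hα)

/-! ### Locally separated unions -/

/-- A union which is, away from an exceptional set with at most one point, locally one of its closed
totally imperfect members, is closed and totally imperfect. -/
theorem isClosed_and_isTotallyImperfect_of_locally {X : Type u} [TopologicalSpace X] [T1Space X]
    {ι : Type*} {F : ι → Set X} {C A : Set X} (hC : C.Subsingleton)
    (hF : ∀ i, IsClosed (F i)) (hi : ∀ i, IsTotallyImperfect (F i)) (hCA : C ⊆ A)
    (hFA : ∀ i, F i ⊆ A)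
    (hloc : ∀ q, q ∉ C → ∃ U, IsOpen U ∧ q ∈ U ∧ ∃ i, U ∩ A ⊆ F i) :
    IsClosed A ∧ IsTotallyImperfect A := by
  constructor
  · rw [← isOpen_compl_iff, isOpen_iff_mem_nhds]
    intro q hq
    obtain ⟨U, hU, hqU, i, hUi⟩ := hloc q fun h => hq (hCA h)
    filter_upwards [hU.mem_nhds hqU, (hF i).isOpen_compl.mem_nhds fun h => hq (hFA i h)]
      with x hx hx' hxA
    exact hx' (hUi ⟨hx, hxA⟩)
  · intro P hPA hP
    have hsub : P ⊆ C := by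
      intro q hq
      by_contra hqp
      obtain ⟨U, hU, hqU, i, hUi⟩ := hloc q hqp
      have hperf := (hP.acc.open_inter hU).perfect_closure
      have hcl : closure (U ∩ P) ⊆ F i :=
        closure_minimal ((inter_subset_inter_right U hPA).trans hUi) (hF i)
      exact (hi i _ hcl hperf ▸ subset_closure ⟨hqU, hq⟩ : q ∈ (∅ : Set X))
    refine eq_empty_of_forall_notMem fun q hq => ?_
    obtain ⟨y, hy, hyq⟩ := preperfect_iff_nhds.1 hP.acc q hq univ Filter.univ_mem
    exact hyq (hC (hsub hy.2) (hsub hq))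

/-- If points near `q` in different members of a family have distance at least `d`, then a ball of
radius `d / 2` around `q` meets at most one member. -/
theorem exists_ball_inter_iUnion_subset {X : Type u} [PseudoMetricSpace X] {ι : Type*} [Nonempty ι]
    {F : ι → Set X} {q : X} {d : ℝ}
    (hsep : ∀ i j, i ≠ j → ∀ a ∈ F i, ∀ b ∈ F j, a ∈ Metric.ball q d → d ≤ dist a b) :
    ∃ i, Metric.ball q (d / 2) ∩ ⋃ i, F i ⊆ F i := by
  by_cases hex : ∃ i, (Metric.ball q (d / 2) ∩ F i).Nonempty
  · obtain ⟨i, a, haq, hai⟩ := hex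
    refine ⟨i, ?_⟩
    rintro b ⟨hbq, hb⟩
    obtain ⟨j, hbj⟩ := mem_iUnion.1 hb
    by_contra hbi
    have hij : i ≠ j := fun h => hbi (h ▸ hbj)
    rw [Metric.mem_ball] at haq hbq
    have h0 : 0 ≤ dist a q := dist_nonneg
    have h3 := hsep i j hij a hai b hbj (by rw [Metric.mem_ball]; linarith)
    have h5 := dist_triangle_right a b q
    linarith
  · refine ⟨Classical.arbitrary ι, ?_⟩
    rintro b ⟨hbq, hb⟩
    obtain ⟨j, hbj⟩ := mem_iUnion.1 hb
    exact absurd ⟨j, b, hbq, hbj⟩ hex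

/-- A neighbourhood of `q` small against its distance from `p` meets at most one member of a family
whose distances from each other are at least proportional to the distances from `p`. -/
theorem exists_isOpen_inter_iUnion_subset {X : Type u} [PseudoMetricSpace X] {ι : Type*}
    [Nonempty ι] {F : ι → Set X} {p q : X} {c : ℝ} (hc : 0 < c)
    (hsep : ∀ i j, i ≠ j → ∀ a ∈ F i, ∀ b ∈ F j, c * dist a p ≤ dist a b)
    (hq : 0 < dist q p) :
    ∃ U, IsOpen U ∧ q ∈ U ∧ p ∉ U ∧ ∃ i, U ∩ ⋃ i, F i ⊆ F i := by
  set d := min (dist q p / 2) (c * (dist q p / 2))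
  have hd : 0 < d := lt_min (by positivity) (by positivity)
  have h1 : d ≤ dist q p / 2 := min_le_left _ _
  refine ⟨Metric.ball q (d / 2), Metric.isOpen_ball, Metric.mem_ball_self (by positivity),
    fun h => ?_, exists_ball_inter_iUnion_subset fun i j hij a ha b hb haq => ?_⟩
  · rw [Metric.mem_ball, dist_comm] at h
    linarith
  · have h4 := dist_triangle_left q p a
    rw [Metric.mem_ball] at haq
    calc d ≤ c * (dist q p / 2) := min_le_right _ _
      _ ≤ c * dist a p := by gcongr; linarith
      _ ≤ dist a b := hsep i j hij a ha b hb

/-! ### Sets of prescribed rank in a nonseparable space -/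

/-- A nonseparable metric space contains an uncountable set with distances bounded below. -/
theorem exists_uncountable_pairwise_le_dist {X : Type u} [PseudoMetricSpace X]
    (hX : ¬ TopologicalSpace.SeparableSpace X) :
    ∃ ε > 0, ∃ S : Set X, ¬ S.Countable ∧ S.Pairwise fun x y => ε ≤ dist x y := by
  by_contra! hcon
  refine hX (@TopologicalSpace.SecondCountableTopology.to_separableSpace _ _
    (Metric.secondCountable_of_almost_dense_set fun ε hε => ?_))
  obtain ⟨S, hS⟩ := zorn_subset {S : Set X | S.Pairwise fun x y => ε ≤ dist x y}
    fun c hc hchain => ⟨⋃₀ c, (pairwise_sUnion hchain.directedOn).2 fun s hs => hc hs,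
      fun s hs => subset_sUnion_of_mem hs⟩
  refine ⟨S, by_contra fun h => hcon ε hε S h hS.prop, fun x => ?_⟩
  by_contra! hx
  have hins : (insert x S).Pairwise fun x y => ε ≤ dist x y :=
    pairwise_insert.2 ⟨hS.prop, fun y hy _ => ⟨(hx y hy).le, dist_comm x y ▸ (hx y hy).le⟩⟩
  have := hx x (hS.le_of_ge hins (subset_insert x S) (mem_insert x S))
  rw [dist_self] at this
  exact lt_asymm this hε

/-- In a nonseparable normed space the annulus `1 ≤ ‖x‖ ≤ 2` contains an uncountable separated
set. -/
theorem exists_uncountable_separated_annulus {X : Type u} [NormedAddCommGroup X] [NormedSpace ℝ X]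
    (hX : ¬ TopologicalSpace.SeparableSpace X) :
    ∃ ε > 0, ε ≤ 1 ∧ ∃ I : Set X, ¬ I.Countable ∧ (∀ x ∈ I, 1 ≤ ‖x‖ ∧ ‖x‖ ≤ 2) ∧
      I.Pairwise fun x y => ε ≤ dist x y := by
  obtain ⟨ε, hε, S, hS, hsep⟩ := exists_uncountable_pairwise_le_dist hX
  obtain ⟨N, hN⟩ : ∃ N : ℕ, ¬ (S ∩ Metric.closedBall 0 (N + 1)).Countable := by
    by_contra! h
    refine hS ((countable_iUnion h).mono fun x hx => ?_)
    obtain ⟨N, hN⟩ := exists_nat_ge ‖x‖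
    exact mem_iUnion.2 ⟨N, hx, by rw [mem_closedBall_zero_iff]; linarith⟩
  have : Nontrivial X := by
    rw [← not_subsingleton_iff_nontrivial]
    exact fun h => hX inferInstance
  obtain ⟨e, he⟩ := exists_norm_eq X (c := (3 / 2 : ℝ)) (by norm_num)
  set t : ℝ := (2 * (N + 1))⁻¹ with ht
  have ht0 : 0 < t := by positivity
  have htN : t * (N + 1) = 1 / 2 := by rw [ht]; field_simp
  let g : X → X := fun y => e + t • y
  have hdist : ∀ x y, dist (g x) (g y) = t * dist x y := fun x y => by
    simp only [g, dist_add_left, dist_smul₀, Real.norm_of_nonneg ht0.le]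
  have hginj : Function.Injective g := fun x y h => by
    have := hdist x y
    rw [h, dist_self] at this
    exact dist_eq_zero.1 ((mul_eq_zero.1 this.symm).resolve_left ht0.ne')
  refine ⟨min (t * ε) 1, by positivity, min_le_right _ _,
    g '' (S ∩ Metric.closedBall 0 (N + 1)), ?_, ?_, ?_⟩
  · exact fun h => hN (countable_of_injective_of_countable_image hginj.injOn h)
  · rintro _ ⟨y, ⟨-, hy⟩, rfl⟩
    rw [mem_closedBall_zero_iff] at hy
    have h1 : ‖t • y‖ ≤ 1 / 2 := by
      rw [norm_smul, Real.norm_of_nonneg ht0.le, ← htN]; gcongr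
    have h2 := norm_add_le e (t • y)
    have h3 := norm_sub_le (e + t • y) (t • y)
    rw [add_sub_cancel_right] at h3
    constructor <;> simp only [g] <;> linarith
  · rintro _ ⟨x, hx, rfl⟩ _ ⟨y, hy, rfl⟩ hxy
    refine (min_le_left _ _).trans ?_
    rw [hdist]
    gcongr
    exact hsep hx.1 hy.1 fun h => hxy (h ▸ rfl)

theorem countable_Iio_of_lt_omega_one {α : Ordinal.{u}} (h : α < ω_ 1) : (Iio α).Countable := by
  rw [← Set.countable_coe_iff, ← Cardinal.mk_le_aleph0_iff, Cardinal.mk_Iio_ordinal,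
    Cardinal.lift_le_aleph0]
  rw [← Cardinal.lt_aleph_one_iff]
  exact Cardinal.lt_ord.1 (by rwa [Cardinal.ord_aleph])

theorem exists_injective_Iio_of_le_omega_one {X : Type u} {I : Set X} (hI : ¬ I.Countable)
    {γ : Ordinal.{u}} (h : γ ≤ ω_ 1) : ∃ f : Iio γ → I, Function.Injective f := by
  have h1 : Cardinal.lift.{u} (Cardinal.mk (Iio γ)) ≤ Cardinal.lift.{u + 1} (Cardinal.mk I) := by
    rw [Cardinal.mk_Iio_ordinal, Cardinal.lift_lift, Cardinal.lift_le]
    refine (Ordinal.card_le_card h).trans ?_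
    rw [Ordinal.card_omega, Cardinal.aleph_one_le_iff, ← not_le, Cardinal.mk_le_aleph0_iff]
    exact hI
  obtain ⟨f⟩ := Cardinal.lift_mk_le'.1 h1
  exact ⟨f, f.injective⟩

/-- A sequence which takes every value in a countable nonempty set infinitely often. -/
theorem exists_nat_seq_frequently {α : Type*} [Countable α] [Nonempty α] :
    ∃ g : ℕ → α, ∀ a N, ∃ n, N ≤ n ∧ g n = a := by
  obtain ⟨f, hf⟩ := exists_surjective_nat α
  refine ⟨fun n => f n.unpair.1, fun a N => ?_⟩
  obtain ⟨k, rfl⟩ := hf a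
  exact ⟨Nat.pair k N, Nat.right_le_pair k N, by simp⟩

theorem mem_iterCondDeriv_of_forall_succ {X : Type u} [TopologicalSpace X] {A : Set X} {p : X}
    {α : Ordinal.{u}} (h0 : α ≠ 0) (h : ∀ β < α, p ∈ iterCondDeriv A (Order.succ β)) :
    p ∈ iterCondDeriv A α := by
  rcases Ordinal.zero_or_succ_or_isSuccLimit α with rfl | ⟨β, rfl⟩ | hl
  · exact absurd rfl h0
  · exact h β (Order.lt_succ β)
  · rw [iterCondDeriv_limit A α hl]
    simp only [mem_iInter]
    exact fun β hβ hpos => iterCondDeriv_anti A hpos (Order.le_succ β) (h β hβ)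

/-- For every countable ordinal `α`, every ball of a nonseparable normed space contains a closed
totally imperfect set whose `α`-th derivative contains the centre and whose next derivative is
empty: around the centre, on spheres shrinking to it, one puts uncountable families of such sets for
smaller ordinals, each smaller ordinal being used on infinitely many spheres. -/
theorem exists_isClosed_isTotallyImperfect_iterCondDeriv {X : Type u} [NormedAddCommGroup X]
    [NormedSpace ℝ X] {ε : ℝ} (hε : 0 < ε) (hε1 : ε ≤ 1) {I : Set X} (hI : ¬ I.Countable)
    (hnorm : ∀ x ∈ I, 1 ≤ ‖x‖ ∧ ‖x‖ ≤ 2) (hsep : I.Pairwise fun x y => ε ≤ dist x y)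
    (α : Ordinal.{u}) (hα : α < ω_ 1) (p : X) (r : ℝ) (hr : 0 < r) :
    ∃ A : Set X, IsClosed A ∧ IsTotallyImperfect A ∧ A ⊆ Metric.closedBall p r ∧
      p ∈ iterCondDeriv A α ∧ iterCondDeriv A (Order.succ α) = ∅ := by
  induction α using WellFoundedLT.induction generalizing p r with
  | _ α ih =>
  rcases eq_or_ne α 0 with rfl | h0
  · refine ⟨{p}, isClosed_singleton, fun P hP hperf => ?_, ?_, ?_, ?_⟩
    · refine eq_empty_of_forall_notMem fun q hq => ?_
      obtain ⟨y, hy, hyq⟩ := preperfect_iff_nhds.1 hperf.acc q hq univ Filter.univ_mem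
      exact hyq ((hP hy.2).trans (hP hq).symm)
    · exact singleton_subset_iff.2 (Metric.mem_closedBall_self hr.le)
    · rw [iterCondDeriv_zero]; exact mem_singleton p
    · rw [iterCondDeriv_succ, iterCondDeriv_zero]
      exact condDeriv_eq_empty_of_countable (countable_singleton p)
  have : Countable (Iio α) := countable_Iio_of_lt_omega_one hα
  have : Nonempty (Iio α) := ⟨⟨0, pos_iff_ne_zero.2 h0⟩⟩
  have hIne : I.Nonempty := nonempty_iff_ne_empty.2 fun h => hI (h ▸ countable_empty)
  have : Nonempty I := hIne.to_subtype
  obtain ⟨g, hg⟩ := exists_nat_seq_frequently (α := Iio α)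
  -- the scale of the `n`-th sphere
  let s : ℕ → ℝ := fun n => r / 3 * (1 / 4) ^ n
  have hs : ∀ n, 0 < s n := fun n => by positivity
  have hsr : ∀ n, 3 * s n ≤ r := fun n => by
    have : ((1 : ℝ) / 4) ^ n ≤ 1 := pow_le_one₀ (by norm_num) (by norm_num)
    have : r / 3 * (1 / 4) ^ n ≤ r / 3 * 1 := by gcongr
    simp only [s]; linarith
  have hs4 : ∀ n m, n < m → s m ≤ s n / 4 := fun n m h => by
    have : ((1 : ℝ) / 4) ^ m ≤ (1 / 4) ^ (n + 1) :=
      pow_le_pow_of_le_one (by norm_num) (by norm_num) h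
    have : r / 3 * (1 / 4) ^ m ≤ r / 3 * (1 / 4) ^ (n + 1) := by gcongr
    simp only [s]; rw [pow_succ] at this; linarith
  have hpiece : ∀ k : ℕ × I, ∃ A : Set X, IsClosed A ∧ IsTotallyImperfect A ∧
      A ⊆ Metric.closedBall (p + s k.1 • (k.2 : X)) (s k.1 * ε / 4) ∧
      p + s k.1 • (k.2 : X) ∈ iterCondDeriv A (g k.1) ∧
      iterCondDeriv A (Order.succ (g k.1 : Ordinal.{u})) = ∅ := fun k =>
    ih (g k.1) (g k.1).2 ((g k.1).2.trans hα) _ _ (by have := hs k.1; positivity)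
  choose F hFc hFi hFb hFp hFe using hpiece
  have hcen : ∀ k : ℕ × I, s k.1 ≤ dist (p + s k.1 • (k.2 : X)) p ∧
      dist (p + s k.1 • (k.2 : X)) p ≤ 2 * s k.1 := fun k => by
    have h1 := hnorm k.2 k.2.2
    have h2 := hs k.1
    rw [dist_self_add_left, norm_smul, Real.norm_of_nonneg h2.le]
    constructor <;> nlinarith
  have hρ : ∀ n, s n * ε / 4 ≤ s n / 4 := fun n => by
    have := mul_le_mul_of_nonneg_left hε1 (hs n).le; linarith
  have hdp : ∀ k, ∀ a ∈ F k, 3 / 4 * s k.1 ≤ dist a p ∧ dist a p ≤ 9 / 4 * s k.1 := by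
    intro k a ha
    have h1 := hcen k
    have h2 : dist a (p + s k.1 • (k.2 : X)) ≤ s k.1 * ε / 4 := hFb k ha
    have h3 := hρ k.1
    have h4 := dist_triangle a (p + s k.1 • (k.2 : X)) p
    have h5 := dist_triangle_left (p + s k.1 • (k.2 : X)) p a
    constructor <;> linarith
  have hdd : ∀ k l, k.1 < l.1 → ∀ a ∈ F k, ∀ b ∈ F l,
      3 / 16 * s k.1 ≤ dist a b ∧ dist b p ≤ 9 / 16 * s k.1 := by
    intro k l hkl a ha b hb
    have h1 := hdp k a ha
    have h2 := hdp l b hb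
    have h3 := hs4 _ _ hkl
    have h4 := dist_triangle a b p
    constructor <;> linarith
  have hFsep : ∀ k l, k ≠ l → ∀ a ∈ F k, ∀ b ∈ F l, ε / 16 * dist a p ≤ dist a b := by
    intro k l hkl a ha b hb
    have h16 : ε / 16 * dist a p ≤ 1 / 16 * dist a p := by gcongr
    rcases lt_trichotomy k.1 l.1 with h | h | h
    · have h1 := hdp k a ha
      have h2 := hdd k l h a ha b hb
      have := hs k.1
      linarith
    · have hne : (k.2 : X) ≠ l.2 := fun h' => hkl (Prod.ext h (Subtype.ext h'))
      have h1 := hsep k.2.2 l.2.2 hne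
      have h2 : dist (p + s k.1 • (k.2 : X)) (p + s l.1 • (l.2 : X)) =
          s k.1 * dist (k.2 : X) l.2 := by
        rw [← h, dist_add_left, dist_smul₀, Real.norm_of_nonneg (hs _).le]
      have h3 : dist a (p + s k.1 • (k.2 : X)) ≤ s k.1 * ε / 4 := hFb k ha
      have h4 : dist b (p + s l.1 • (l.2 : X)) ≤ s k.1 * ε / 4 := h ▸ hFb l hb
      have h5 := dist_triangle4 (p + s k.1 • (k.2 : X)) a b (p + s l.1 • (l.2 : X))
      rw [dist_comm _ a] at h5
      have h6 := mul_le_mul_of_nonneg_left h1 (hs k.1).le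
      have h7 : ε / 16 * dist a p ≤ ε / 16 * (9 / 4 * s k.1) := by
        gcongr; exact (hdp k a ha).2
      have h8 : 0 < s k.1 * ε := mul_pos (hs _) hε
      linarith
    · have h2 := hdd l k h b hb a ha
      have := hs l.1
      rw [dist_comm a b]
      linarith
  have hloc : ∀ q, q ≠ p → ∃ U, IsOpen U ∧ q ∈ U ∧ ∃ i, U ∩ ({p} ∪ ⋃ i, F i) ⊆ F i := by
    intro q hq
    obtain ⟨U, hU, hqU, hpU, i, hi⟩ :=
      exists_isOpen_inter_iUnion_subset (by positivity) hFsep (dist_pos.2 hq)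
    refine ⟨U, hU, hqU, i, ?_⟩
    rintro x ⟨hxU, rfl | hx⟩
    · exact absurd hxU hpU
    · exact hi ⟨hxU, hx⟩
  have hFA : ∀ k, F k ⊆ {p} ∪ ⋃ i, F i := fun k =>
    (subset_iUnion F k).trans subset_union_right
  obtain ⟨hAc, hAi⟩ := isClosed_and_isTotallyImperfect_of_locally
    subsingleton_singleton hFc hFi subset_union_left hFA hloc
  refine ⟨{p} ∪ ⋃ i, F i, hAc, hAi, ?_, ?_, ?_⟩
  · rintro x (rfl | hx)
    · exact Metric.mem_closedBall_self hr.le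
    · obtain ⟨k, hk⟩ := mem_iUnion.1 hx
      have h1 := hdp k x hk
      have h2 := hsr k.1
      have := hs k.1
      rw [Metric.mem_closedBall]; linarith
  · refine mem_iterCondDeriv_of_forall_succ h0 fun β hβ => ?_
    rw [iterCondDeriv_succ]
    intro U hU hc
    obtain ⟨δ, hδ, hball⟩ := Metric.mem_nhds_iff.1 hU
    obtain ⟨N, hN⟩ := exists_pow_lt_of_lt_one (show 0 < δ / r by positivity)
      (show (1 / 4 : ℝ) < 1 by norm_num)
    obtain ⟨n, hn, hgn⟩ := hg ⟨β, hβ⟩ N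
    have hsn : 2 * s n < δ := by
      have h1 : ((1 : ℝ) / 4) ^ n ≤ (1 / 4) ^ N :=
        pow_le_pow_of_le_one (by norm_num) (by norm_num) hn
      have h2 : (1 / 4 : ℝ) ^ n * r < δ := (lt_div_iff₀ hr).1 (h1.trans_lt hN)
      have := hs n
      simp only [s] at this ⊢
      linarith
    refine hI (countable_of_injective_of_countable_image (f := fun x => p + s n • x) ?_
      (hc.mono ?_))
    · intro x _ y _ hxy
      exact smul_right_injective X (hs n).ne' (add_left_cancel hxy)
    · rintro _ ⟨x, hx, rfl⟩
      have h1 := hFp (n, ⟨x, hx⟩)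
      simp only [hgn] at h1
      refine ⟨hball ?_, iterCondDeriv_mono (hFA _) β h1⟩
      exact (hcen (n, ⟨x, hx⟩)).2.trans_lt hsn
  · rw [iterCondDeriv_succ]
    refine condDeriv_eq_empty_of_countable ((countable_singleton p).mono fun q hq => ?_)
    by_contra hqp
    obtain ⟨U, hU, hqU, k, hk⟩ := hloc q hqp
    have h1 := iterCondDeriv_inter_subset hU hk α ⟨hqU, hq⟩
    have h2 := iterCondDeriv_anti (F k) (zero_le.trans_lt (Order.lt_succ _))
      (Order.succ_le_of_lt (g k.1).2) h1
    rw [hFe k] at h2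
    exact h2

/-- In a nonseparable normed space, every `γ` with `1 ≤ γ ≤ ω₁` is the first ordinal at which the
iterated derivative of some closed totally imperfect set is empty. -/
theorem exists_iterCondDeriv_eq_empty {X : Type u} [NormedAddCommGroup X] [NormedSpace ℝ X]
    (hX : ¬ TopologicalSpace.SeparableSpace X) {γ : Ordinal.{u}} (h0 : 0 < γ) (hγ : γ ≤ ω_ 1) :
    ∃ A : Set X, IsClosed A ∧ IsTotallyImperfect A ∧ iterCondDeriv A γ = ∅ ∧
      ∀ β < γ, (iterCondDeriv A β).Nonempty := by
  obtain ⟨ε, hε, hε1, I, hI, hnorm, hsep⟩ := exists_uncountable_separated_annulus hX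
  obtain ⟨f, hf⟩ := exists_injective_Iio_of_le_omega_one hI hγ
  have : Nonempty (Iio γ) := ⟨⟨0, h0⟩⟩
  have hpiece : ∀ β : Iio γ, _ := fun β =>
    exists_isClosed_isTotallyImperfect_iterCondDeriv hε hε1 hI hnorm hsep β (β.2.trans_le hγ)
      (f β : X) (ε / 4) (by positivity)
  choose F hFc hFi hFb hFp hFe using hpiece
  have hsepF : ∀ β β', β ≠ β' → ∀ a ∈ F β, ∀ b ∈ F β', ε / 2 ≤ dist a b := by
    intro β β' hne a ha b hb
    have h1 := hsep (f β).2 (f β').2 fun h => hne (hf (Subtype.ext h))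
    have h2 : dist a (f β : X) ≤ ε / 4 := hFb β ha
    have h3 : dist b (f β' : X) ≤ ε / 4 := hFb β' hb
    have h5 := dist_triangle4 (f β : X) a b (f β')
    rw [dist_comm _ a] at h5
    linarith
  have hloc : ∀ q, q ∉ (∅ : Set X) → ∃ U, IsOpen U ∧ q ∈ U ∧ ∃ i, U ∩ ⋃ i, F i ⊆ F i :=
    fun q _ => ⟨_, Metric.isOpen_ball, Metric.mem_ball_self (by positivity),
      exists_ball_inter_iUnion_subset fun β β' hne a ha b hb _ => hsepF β β' hne a ha b hb⟩
  obtain ⟨hAc, hAi⟩ := isClosed_and_isTotallyImperfect_of_locally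
    subsingleton_empty hFc hFi (empty_subset _) (subset_iUnion F) hloc
  refine ⟨⋃ β, F β, hAc, hAi, ?_, fun β hβ =>
    ⟨_, iterCondDeriv_mono (subset_iUnion F ⟨β, hβ⟩) β (hFp ⟨β, hβ⟩)⟩⟩
  refine eq_empty_of_forall_notMem fun q hq => ?_
  obtain ⟨U, hU, hqU, β, hβ⟩ := hloc q (notMem_empty q)
  have h1 := iterCondDeriv_inter_subset hU hβ γ ⟨hqU, hq⟩
  have h2 := iterCondDeriv_anti (F β) (zero_le.trans_lt (Order.lt_succ _))
    (Order.succ_le_of_lt β.2) h1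
  rw [hFe β] at h2
  exact h2

open scoped BoundedContinuousFunction

/-! ### The modulus of a functional on bounded functions -/

section Modulus

variable {Γ : Type*} [TopologicalSpace Γ]

/-- The values of a functional on the functions dominated by `g`. Their supremum is the value at `g`
of the modulus of the functional. -/
def dominatedValues (μ : (Γ →ᵇ ℝ) →L[ℝ] ℝ) (g : Γ →ᵇ ℝ) : Set ℝ :=
  μ '' {f | ∀ t, |f t| ≤ g t}

theorem dominatedValues_le (μ : (Γ →ᵇ ℝ) →L[ℝ] ℝ) (g : Γ →ᵇ ℝ) :
    ‖μ‖ * ‖g‖ ∈ upperBounds (dominatedValues μ g) := by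
  rintro _ ⟨f, hf, rfl⟩
  have h1 : ‖f‖ ≤ ‖g‖ := (BoundedContinuousFunction.norm_le (norm_nonneg g)).2 fun t =>
    (hf t).trans ((le_abs_self _).trans (g.norm_coe_le_norm t))
  calc μ f ≤ ‖μ f‖ := le_abs_self _
    _ ≤ ‖μ‖ * ‖f‖ := μ.le_opNorm f
    _ ≤ ‖μ‖ * ‖g‖ := by gcongr

theorem zero_mem_dominatedValues (μ : (Γ →ᵇ ℝ) →L[ℝ] ℝ) {g : Γ →ᵇ ℝ} (hg : 0 ≤ g) :
    0 ∈ dominatedValues μ g :=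
  ⟨0, fun t => by simpa using hg t, map_zero μ⟩

theorem sSup_dominatedValues_add (μ : (Γ →ᵇ ℝ) →L[ℝ] ℝ) {g h : Γ →ᵇ ℝ} (hg : 0 ≤ g) (hh : 0 ≤ h) :
    sSup (dominatedValues μ (g + h)) =
      sSup (dominatedValues μ g) + sSup (dominatedValues μ h) := by
  have hbdd : ∀ k, BddAbove (dominatedValues μ k) := fun k => ⟨_, dominatedValues_le μ k⟩
  rw [← csSup_add ⟨0, zero_mem_dominatedValues μ hg⟩ (hbdd g) ⟨0, zero_mem_dominatedValues μ hh⟩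
    (hbdd h)]
  congr 1
  ext y
  constructor
  · rintro ⟨f, hf, rfl⟩
    -- the Riesz decomposition of `f`: its truncation at height `g`, and the rest
    refine ⟨μ ((f ⊓ g) ⊔ (-g)), ⟨_, fun t => ?_, rfl⟩, μ (f - (f ⊓ g) ⊔ (-g)), ⟨_, fun t => ?_, rfl⟩,
      ?_⟩
    rotate_left 2
    · exact (map_add μ _ _).symm.trans (congrArg μ (add_sub_cancel _ f))
    · have h1 : 0 ≤ g t := hg t
      simp only [BoundedContinuousFunction.coe_sup, BoundedContinuousFunction.coe_inf,
        BoundedContinuousFunction.coe_neg, Pi.sup_apply, Pi.inf_apply, Pi.neg_apply]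
      rw [abs_le]
      exact ⟨le_sup_right, sup_le inf_le_right (by linarith)⟩
    · have h1 : 0 ≤ g t := hg t
      have h2 : 0 ≤ h t := hh t
      have h3 : |f t| ≤ g t + h t := hf t
      simp only [BoundedContinuousFunction.coe_sup, BoundedContinuousFunction.coe_inf,
        BoundedContinuousFunction.coe_neg, BoundedContinuousFunction.coe_sub, Pi.sub_apply,
        Pi.sup_apply, Pi.inf_apply, Pi.neg_apply]
      rw [abs_le] at h3 ⊢
      rcases le_total (f t) (g t) with h4 | h4
      · rw [inf_eq_left.2 h4]
        rcases le_total (f t) (-g t) with h5 | h5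
        · rw [sup_eq_right.2 h5]; constructor <;> linarith
        · rw [sup_eq_left.2 h5]; constructor <;> linarith
      · rw [inf_eq_right.2 h4, sup_eq_left.2 (by linarith)]; constructor <;> linarith
  · rintro ⟨_, ⟨f₁, h₁, rfl⟩, _, ⟨f₂, h₂, rfl⟩, rfl⟩
    exact ⟨f₁ + f₂, fun t => (abs_add_le _ _).trans (add_le_add (h₁ t) (h₂ t)), map_add μ _ _⟩

/-- Every bounded functional `μ` on bounded functions has a modulus `|μ|`: a linear functional whose
value at `g ≥ 0` is the supremum of the values of `μ` at the functions dominated by `g`. -/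
theorem exists_modulus (μ : (Γ →ᵇ ℝ) →L[ℝ] ℝ) :
    ∃ φ : (Γ →ᵇ ℝ) →ₗ[ℝ] ℝ, ∀ g, 0 ≤ g → IsLUB (dominatedValues μ g) (φ g) := by
  let q : (Γ →ᵇ ℝ) → ℝ := fun g => sSup (dominatedValues μ g)
  have hlub : ∀ g, 0 ≤ g → IsLUB (dominatedValues μ g) (q g) := fun g hg =>
    isLUB_csSup ⟨0, zero_mem_dominatedValues μ hg⟩ ⟨_, dominatedValues_le μ g⟩
  have hq0 : ∀ g, 0 ≤ g → 0 ≤ q g := fun g hg => (hlub g hg).1 (zero_mem_dominatedValues μ hg)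
  have hqle : ∀ g, 0 ≤ g → q g ≤ ‖μ‖ * ‖g‖ := fun g hg => (hlub g hg).2 (dominatedValues_le μ g)
  have hqadd : ∀ g h, 0 ≤ g → 0 ≤ h → q (g + h) = q g + q h := fun g h hg hh =>
    sSup_dominatedValues_add μ hg hh
  have hadd : ∀ g h : Γ →ᵇ ℝ, q (g + h)⁺ - q (g + h)⁻ = (q g⁺ - q g⁻) + (q h⁺ - q h⁻) := by
    intro g h
    have key : (g + h)⁺ + (g⁻ + h⁻) = (g + h)⁻ + (g⁺ + h⁺) := by
      have h1 := posPart_sub_negPart (g + h)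
      have h2 := posPart_sub_negPart g
      have h3 := posPart_sub_negPart h
      rw [← sub_eq_zero]
      calc _ = ((g + h)⁺ - (g + h)⁻) - (g⁺ - g⁻) - (h⁺ - h⁻) := by abel
        _ = 0 := by rw [h1, h2, h3]; abel
    have h4 := congrArg q key
    rw [hqadd _ _ (posPart_nonneg _) (add_nonneg (negPart_nonneg _) (negPart_nonneg _)),
      hqadd _ _ (negPart_nonneg _) (add_nonneg (posPart_nonneg _) (posPart_nonneg _)),
      hqadd _ _ (negPart_nonneg _) (negPart_nonneg _),
      hqadd _ _ (posPart_nonneg _) (posPart_nonneg _)] at h4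
    linarith
  let φ₀ : (Γ →ᵇ ℝ) →+ ℝ := AddMonoidHom.mk' (fun g => q g⁺ - q g⁻) hadd
  have hcont : Continuous φ₀ := by
    refine AddMonoidHomClass.continuous_of_bound φ₀ ‖μ‖ fun g => ?_
    have hp : ‖g⁺‖ ≤ ‖g‖ := norm_le_norm_of_abs_le_abs (by
      rw [abs_of_nonneg (posPart_nonneg g)]; exact sup_le (le_abs_self g) (abs_nonneg g))
    have hn : ‖g⁻‖ ≤ ‖g‖ := norm_le_norm_of_abs_le_abs (by
      rw [abs_of_nonneg (negPart_nonneg g)]; exact sup_le (neg_le_abs g) (abs_nonneg g))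
    have h1 := hqle _ (posPart_nonneg g)
    have h2 := hqle _ (negPart_nonneg g)
    have h3 := hq0 _ (posPart_nonneg g)
    have h4 := hq0 _ (negPart_nonneg g)
    have h5 := mul_le_mul_of_nonneg_left hp (norm_nonneg μ)
    have h6 := mul_le_mul_of_nonneg_left hn (norm_nonneg μ)
    change |q g⁺ - q g⁻| ≤ _
    rw [abs_le]
    constructor <;> linarith
  refine ⟨(φ₀.toRealLinearMap hcont).toLinearMap, fun g hg => ?_⟩
  have hq00 : q 0 = 0 := le_antisymm (by simpa using hqle 0 le_rfl) (hq0 0 le_rfl)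
  have : (φ₀.toRealLinearMap hcont) g = q g := by
    change q g⁺ - q g⁻ = q g
    rw [posPart_of_nonneg hg, negPart_of_nonneg hg, hq00, _root_.sub_zero]
  change IsLUB _ ((φ₀.toRealLinearMap hcont) g)
  rw [this]
  exact hlub g hg

end Modulus

/-! ### Spaces of bounded functions on which an `L²`-seminorm dominates the uniform norm -/

/-- A space of bounded functions on which the uniform norm is dominated by the `L²`-seminorm of a
positive functional `φ` is finite-dimensional. For orthonormal `e₀, …, e_{N-1}` in it, the bound
applied to `∑ eᵢ(t) eᵢ` gives `∑ eᵢ(t)² ≤ K`, and applying `φ` gives `N ≤ K φ(1)`. -/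
theorem finiteDimensional_of_sq_le {Γ V : Type*} [TopologicalSpace Γ] [AddCommGroup V] [Module ℝ V]
    (j : V →ₗ[ℝ] (Γ →ᵇ ℝ)) (hj : Function.Injective j) (φ : (Γ →ᵇ ℝ) →ₗ[ℝ] ℝ)
    (hφ : ∀ g, 0 ≤ g → 0 ≤ φ g) {K : ℝ} (hK0 : 0 ≤ K)
    (hK : ∀ x t, (j x t) ^ 2 ≤ K * φ (j x * j x)) :
    FiniteDimensional ℝ V := by
  by_contra hfin
  let core : InnerProductSpace.Core ℝ V :=
    { inner := fun x y => φ (j x * j y)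
      conj_inner_symm := fun x y => by simp [mul_comm]
      re_inner_nonneg := fun x => hφ _ fun t => mul_self_nonneg (j x t)
      add_left := fun x y z => by simp [add_mul]
      smul_left := fun x y r => by rw [map_smul j, smul_mul_assoc, map_smul φ]; rfl
      definite := fun x hx => hj (by
        rw [map_zero]
        ext t
        have := hK x t
        rw [show φ (j x * j x) = 0 from hx, mul_zero] at this
        exact pow_eq_zero_iff two_ne_zero |>.1 (le_antisymm this (sq_nonneg _))) }
  let : NormedAddCommGroup V := core.toNormedAddCommGroup
  let : InnerProductSpace ℝ V := InnerProductSpace.ofCore core.toCore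
  have hinner : ∀ x y : V, inner ℝ x y = φ (j x * j y) := fun x y => rfl
  have hinf : Infinite (Module.Basis.ofVectorSpaceIndex ℝ V) := by
    by_contra h
    rw [not_infinite_iff_finite] at h
    exact hfin (Module.Finite.of_basis (Module.Basis.ofVectorSpace ℝ V))
  have hli : LinearIndependent ℝ fun n : ℕ =>
      Module.Basis.ofVectorSpace ℝ V (Infinite.natEmbedding _ n) :=
    (Module.Basis.ofVectorSpace ℝ V).linearIndependent.comp _ (Infinite.natEmbedding _).injective
  have horth := InnerProductSpace.gramSchmidtNormed_orthonormal hli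
  set e := InnerProductSpace.gramSchmidtNormed ℝ fun n : ℕ =>
      Module.Basis.ofVectorSpace ℝ V (Infinite.natEmbedding _ n)
  have hpt : ∀ (N : ℕ) (t : Γ), ∑ i ∈ Finset.range N, (j (e i) t) ^ 2 ≤ K := by
    intro N t
    set S := ∑ i ∈ Finset.range N, (j (e i) t) ^ 2
    have hS0 : 0 ≤ S := Finset.sum_nonneg fun i _ => sq_nonneg _
    set x := ∑ i ∈ Finset.range N, j (e i) t • e i with hx
    have h1 : j x t = S := by
      simp [hx, S, pow_two, BoundedContinuousFunction.coe_sum]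
    have h2 : φ (j x * j x) = S := by
      rw [← hinner, hx, horth.inner_sum]
      simp [S, pow_two]
    have h3 := hK x t
    rw [h1, h2] at h3
    rcases hS0.eq_or_lt with h | h
    · rwa [← h]
    · nlinarith
  have hN : ∀ N : ℕ, (N : ℝ) ≤ K * φ 1 := by
    intro N
    have h1 : φ (∑ i ∈ Finset.range N, j (e i) * j (e i)) = N := by
      rw [map_sum]
      have : ∀ i, φ (j (e i) * j (e i)) = 1 := fun i => by
        rw [← hinner, real_inner_self_eq_norm_sq, horth.1 i, one_pow]
      simp [this]
    have h2 : 0 ≤ φ (K • 1 - ∑ i ∈ Finset.range N, j (e i) * j (e i)) := hφ _ fun t => by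
      have := hpt N t
      simpa [BoundedContinuousFunction.coe_sum, ← pow_two] using this
    rw [map_sub, h1, map_smul, _root_.smul_eq_mul] at h2
    linarith
  obtain ⟨N, h⟩ := exists_nat_gt (K * φ 1)
  exact absurd (hN N) (not_le.2 h)

/-! ### Uniformly exhaustive families of set functions -/

/-- **Rosenthal's lemma.** For uniformly bounded superadditive set functions `ν n` there is an
infinite set `M` of indices such that each `n ∈ M` gives small mass to the rest of `M`. Otherwise
one could pass again and again to infinite sets of indices on which the masses are smaller by a
fixed amount. -/
theorem exists_infinite_forall_diff_lt {ν : ℕ → Set ℕ → ℝ} (h0 : ∀ n A, 0 ≤ ν n A)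
    (hmono : ∀ n A B, A ⊆ B → ν n A ≤ ν n B)
    (hadd : ∀ n A B, Disjoint A B → ν n A + ν n B ≤ ν n (A ∪ B)) {C : ℝ}
    (hC : ∀ n, ν n univ ≤ C) {ε : ℝ} (hε : 0 < ε) :
    ∃ M : Set ℕ, M.Infinite ∧ ∀ n ∈ M, ν n (M \ {n}) < ε := by
  by_contra! hcon
  have key : ∀ k : ℕ, ∃ M : Set ℕ, M.Infinite ∧ ∀ n ∈ M, ν n M ≤ C - k * ε := by
    intro k
    induction k with
    | zero => exact ⟨univ, infinite_univ, fun n _ => by simpa using hC n⟩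
    | succ k ih =>
      obtain ⟨M, hM, hle⟩ := ih
      -- split `M` into infinitely many infinite sets
      have : Infinite M := hM.to_subtype
      let f : ℕ ↪ M := Infinite.natEmbedding M
      let L : ℕ → Set ℕ := fun p => range fun m => (f (Nat.pair p m) : ℕ)
      have hLinf : ∀ p, (L p).Infinite := fun p => infinite_range_of_injective fun a b h => by
        simpa using f.injective (Subtype.ext h)
      have hLM : ∀ p, L p ⊆ M := by
        rintro p _ ⟨m, rfl⟩; exact (f _).2
      have hLdisj : ∀ p p', ∀ x, x ∈ L p → x ∈ L p' → p = p' := by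
        rintro p p' _ ⟨m, rfl⟩ ⟨m', h⟩
        have := f.injective (Subtype.ext h)
        exact ((Nat.pair_eq_pair.1 this).1).symm
      choose n hn hnε using fun p => hcon (L p) (hLinf p)
      have hninj : Function.Injective n := fun p p' h => hLdisj p p' _ (hn p) (h ▸ hn p')
      refine ⟨range n, infinite_range_of_injective hninj, ?_⟩
      rintro _ ⟨p, rfl⟩
      have hd : Disjoint (range n) (L p \ {n p}) := by
        rw [disjoint_left]
        rintro _ ⟨p', rfl⟩ ⟨h1, h2⟩
        exact h2 (by rw [hLdisj p' p _ (hn p') h1]; rfl)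
      have hsub : range n ∪ (L p \ {n p}) ⊆ M := by
        refine union_subset ?_ (sdiff_subset.trans (hLM p))
        rintro _ ⟨p', rfl⟩
        exact hLM p' (hn p')
      have h1 := hadd (n p) _ _ hd
      have h2 := hmono (n p) _ _ hsub
      have h3 := hle (n p) (hLM p (hn p))
      have h4 := hnε p
      push_cast
      linarith
  obtain ⟨k, hk⟩ := exists_nat_gt (C / ε)
  obtain ⟨M, hM, hle⟩ := key k
  obtain ⟨n, hn⟩ := hM.nonempty
  have h1 := hle n hn
  have h2 := h0 n M
  have h3 := (div_lt_iff₀ hε).1 hk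
  linarith

section Exhaustive

variable {Γ D : Type*}

/-- A family of set functions is uniformly exhaustive if no sequence of disjoint sets carries, for
suitable members of the family, masses bounded below. -/
def UniformlyExhaustive (ν : D → Set Γ → ℝ) : Prop :=
  ∀ E : ℕ → Set Γ, Pairwise (Function.onFun Disjoint E) → ∀ ε > 0, ∃ n, ∀ d, ν d (E n) ≤ ε

variable {ν : D → Set Γ → ℝ}

theorem UniformlyExhaustive.exists_forall_diff_le_of_monotone (hν : UniformlyExhaustive ν)
    {B : ℕ → Set Γ} (hB : Monotone B) {ε : ℝ} (hε : 0 < ε) :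
    ∃ m, ∀ k, m ≤ k → ∀ d, ν d (B k \ B m) ≤ ε := by
  by_contra! hcon
  choose k hk d hd using hcon
  -- the blocks between the iterates of `k` are disjoint
  let s : ℕ → ℕ := fun n => k^[n] 0
  have hs : ∀ n, s (n + 1) = k (s n) := fun n => Function.iterate_succ_apply' k n 0
  have hsm : Monotone s := monotone_nat_of_le_succ fun n => by rw [hs]; exact hk _
  have hdisj : ∀ m n, m < n → Disjoint (B (s (m + 1)) \ B (s m)) (B (s (n + 1)) \ B (s n)) := by
    intro m n hmn
    rw [disjoint_left]
    exact fun x hx hx' => hx'.2 (hB (hsm hmn) hx.1)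
  obtain ⟨n, hn⟩ := hν (fun n => B (s (n + 1)) \ B (s n)) (fun m n hmn => by
    rcases lt_or_gt_of_ne hmn with h | h
    · exact hdisj m n h
    · exact (hdisj n m h).symm) ε hε
  have := hn (d (s n))
  rw [hs] at this
  exact absurd (hd (s n)) (not_lt.2 this)

theorem UniformlyExhaustive.exists_forall_diff_le_of_antitone (hν : UniformlyExhaustive ν)
    {B : ℕ → Set Γ} (hB : Antitone B) {ε : ℝ} (hε : 0 < ε) :
    ∃ m, ∀ k, m ≤ k → ∀ d, ν d (B m \ B k) ≤ ε := by
  obtain ⟨m, hm⟩ := hν.exists_forall_diff_le_of_monotone (B := fun n => (B n)ᶜ)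
    (fun m n h => compl_subset_compl.2 (hB h)) hε
  refine ⟨m, fun k hk d => ?_⟩
  have := hm k hk d
  rwa [show (B k)ᶜ \ (B m)ᶜ = B m \ B k by ext; simp [and_comm]] at this

/-- A uniformly exhaustive family of monotone subadditive set functions is controlled by finitely
many of its members: a set small for these is small for all members. If not, there are members
`d n` and sets `A n` small for the earlier members but not for `d n`. The unions of consecutive
`A k` are, up to small sets, finite unions `V n`, and the sets `V 0 ∩ ⋯ ∩ V n` decrease, are
eventually small for each `d i`, but the `n`-th is not small for `d n`; so some of their
differences contradict exhaustivity. -/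
theorem UniformlyExhaustive.exists_finset_control (hν : UniformlyExhaustive ν)
    (hmono : ∀ d A B, A ⊆ B → ν d A ≤ ν d B)
    (hsub : ∀ d A B, ν d (A ∪ B) ≤ ν d A + ν d B) (hemp : ∀ d, ν d ∅ = 0) {ε : ℝ} (hε : 0 < ε) :
    ∃ s : Finset D, ∃ δ > 0, ∀ A, (∀ i ∈ s, ν i A < δ) → ∀ d, ν d A ≤ ε := by
  classical
  by_contra! hcon
  obtain ⟨z, hz1, hz2⟩ := exists_seq_of_forall_finset_exists
    (fun x : D × Set Γ × ℕ => ε < ν x.1 x.2.1)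
    (fun x y => x.2.2 < y.2.2 ∧ ν x.1 y.2.1 < (1 / 2) ^ y.2.2) (by
      intro s _
      let N := s.sup (fun x => x.2.2) + 1
      obtain ⟨A, hA, d, hd⟩ := hcon (s.image Prod.fst) ((1 / 2) ^ N) (by positivity)
      refine ⟨(d, A, N), hd, fun x hx => ⟨?_, hA _ (Finset.mem_image_of_mem _ hx)⟩⟩
      exact Nat.lt_succ_of_le (Finset.le_sup (f := fun x : D × Set Γ × ℕ => x.2.2) hx))
  let d : ℕ → D := fun n => (z n).1
  let A : ℕ → Set Γ := fun n => (z n).2.1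
  have hdA : ∀ n, ε < ν (d n) (A n) := hz1
  have hN : ∀ n, n ≤ (z n).2.2 := by
    intro n
    induction n with
    | zero => exact Nat.zero_le _
    | succ n ih => exact ih.trans_lt (hz2 n (n + 1) n.lt_succ_self).1
  have hsmall : ∀ i n, i < n → ν (d i) (A n) ≤ (1 / 2) ^ n := fun i n h =>
    (hz2 i n h).2.le.trans (pow_le_pow_of_le_one (by norm_num) (by norm_num) (hN n))
  let U : ℕ → ℕ → Set Γ := fun n m => ⋃ k ∈ Ico n m, A k
  have hUmono : ∀ n, Monotone (U n) := fun n m m' h =>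
    biUnion_subset_biUnion_left (Ico_subset_Ico_right h)
  choose m hm using fun n => hν.exists_forall_diff_le_of_monotone (hUmono n)
    (show 0 < ε / 2 * (1 / 2) ^ (n + 2) by positivity)
  let V : ℕ → Set Γ := fun n => U n (m n)
  let W : ℕ → Set Γ := fun n => ⋂ i ∈ Iic n, V i
  have hW : Antitone W := fun n n' h => biInter_subset_biInter_left (Iic_subset_Iic.2 h)
  -- each `V i` contains every later `A n` up to a small set
  have hAV : ∀ i n, i ≤ n → ∀ e, ν e (A n \ V i) ≤ ε / 2 * (1 / 2) ^ (i + 2) := by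
    intro i n hin e
    refine le_trans (hmono e _ _ ?_) (hm i (max (m i) (n + 1)) (le_max_left _ _) e)
    refine sdiff_subset_sdiff_left (subset_biUnion_of_mem (u := A) (x := n) ?_)
    exact ⟨hin, lt_max_of_lt_right n.lt_succ_self⟩
  have hAW : ∀ n k, k ≤ n → ∀ e, ν e (A n \ W k) ≤ ε / 2 * (1 - (1 / 2) ^ (k + 1)) := by
    intro n k hk e
    induction k with
    | zero =>
      have : W 0 = V 0 := by simp [W]
      rw [this]
      refine (hAV 0 n hk e).trans ?_
      norm_num
      linarith
    | succ k ih =>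
      have : A n \ W (k + 1) ⊆ (A n \ W k) ∪ (A n \ V (k + 1)) := by
        rintro x ⟨hx, hxW⟩
        by_contra h
        simp only [mem_union, mem_sdiff, not_or, not_and, not_not] at h
        refine hxW (mem_iInter₂.2 fun i hi => ?_)
        rcases Nat.le_succ_iff.1 (mem_Iic.1 hi) with h' | h'
        · exact mem_iInter₂.1 (h.1 hx) i h'
        · exact h' ▸ h.2 hx
      have h1 := hmono e _ _ this
      have h2 := hsub e (A n \ W k) (A n \ V (k + 1))
      have h3 := ih (by omega)
      have h4 := hAV (k + 1) n hk e
      have h5 : (1 / 2 : ℝ) ^ (k + 1 + 2) = (1 / 2) ^ (k + 1) / 4 := by rw [pow_add]; ring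
      have h6 : (1 / 2 : ℝ) ^ (k + 1 + 1) = (1 / 2) ^ (k + 1) / 2 := by rw [pow_succ]; ring
      have h7 : 0 < (1 / 2 : ℝ) ^ (k + 1) := by positivity
      rw [h5] at h4
      rw [h6]
      nlinarith
  have hbig : ∀ n, ε / 2 ≤ ν (d n) (W n) := by
    intro n
    have h1 := hmono (d n) (A n) (W n ∪ (A n \ W n))
      (by rw [union_sdiff_self]; exact subset_union_right)
    have h2 := hsub (d n) (W n) (A n \ W n)
    have h3 := hAW n n le_rfl (d n)
    have h4 := hdA n
    have h5 : 0 < ε / 2 * (1 / 2) ^ (n + 1) := by positivity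
    linarith
  have hWsmall : ∀ i n, i < n → ν (d i) (W n) ≤ 2 * (1 / 2) ^ n := by
    intro i n hin
    refine (hmono _ _ (V n) (biInter_subset_of_mem (mem_Iic.2 le_rfl))).trans ?_
    have : ∀ k, ν (d i) (U n (n + k)) ≤ 2 * (1 / 2) ^ n - 2 * (1 / 2) ^ (n + k) := by
      intro k
      induction k with
      | zero => simp [U, hemp]
      | succ k ih =>
        have h1 : U n (n + (k + 1)) ⊆ U n (n + k) ∪ A (n + k) := iUnion₂_subset fun l hl => by
          rcases (Nat.lt_succ_iff.1 hl.2).lt_or_eq with h | h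
          · have hl' : l ∈ Ico n (n + k) := ⟨hl.1, h⟩
            exact (subset_biUnion_of_mem (u := A) hl').trans subset_union_left
          · exact h ▸ subset_union_right
        have h4 := hmono (d i) _ _ h1
        have h2 := hsub (d i) (U n (n + k)) (A (n + k))
        have h3 := hsmall i (n + k) (by omega)
        have h5 : (1 / 2 : ℝ) ^ (n + (k + 1)) = (1 / 2) ^ (n + k) / 2 := by
          rw [← add_assoc, pow_succ]; ring
        rw [h5]
        linarith
    have h1 := this (m n)
    have h2 := hmono (d i) _ _ (hUmono n (show m n ≤ n + m n by omega))
    have h3 : (0 : ℝ) < (1 / 2) ^ (n + m n) := by positivity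
    linarith
  obtain ⟨k, hk⟩ := hν.exists_forall_diff_le_of_antitone hW (show 0 < ε / 8 by positivity)
  obtain ⟨N, hN⟩ := exists_pow_lt_of_lt_one (show 0 < ε / 8 by positivity)
    (show (1 / 2 : ℝ) < 1 by norm_num)
  have h1 := hk (max (k + 1) N) (by omega) (d k)
  have h2 := hWsmall k (max (k + 1) N) (by omega)
  have h3 : (1 / 2 : ℝ) ^ max (k + 1) N ≤ (1 / 2) ^ N :=
    pow_le_pow_of_le_one (by norm_num) (by norm_num) (le_max_right _ _)
  have h4 := hbig k
  have h5 := hmono (d k) (W k) ((W k \ W (max (k + 1) N)) ∪ W (max (k + 1) N))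
    (by rw [sdiff_union_self]; exact subset_union_left)
  have h6 := hsub (d k) (W k \ W (max (k + 1) N)) (W (max (k + 1) N))
  linarith

end Exhaustive

/-! ### Operators from bounded functions to a separable space -/

section Operator

variable {Γ : Type*} [TopologicalSpace Γ]

/-- The modulus `|μ|` of a bounded functional `μ` on bounded functions. -/
noncomputable def modulus (μ : (Γ →ᵇ ℝ) →L[ℝ] ℝ) : (Γ →ᵇ ℝ) →ₗ[ℝ] ℝ :=
  (exists_modulus μ).choose

theorem isLUB_modulus (μ : (Γ →ᵇ ℝ) →L[ℝ] ℝ) {g : Γ →ᵇ ℝ} (hg : 0 ≤ g) :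
    IsLUB (dominatedValues μ g) (modulus μ g) :=
  (exists_modulus μ).choose_spec g hg

theorem modulus_nonneg (μ : (Γ →ᵇ ℝ) →L[ℝ] ℝ) {g : Γ →ᵇ ℝ} (hg : 0 ≤ g) : 0 ≤ modulus μ g :=
  (isLUB_modulus μ hg).1 (zero_mem_dominatedValues μ hg)

theorem modulus_mono (μ : (Γ →ᵇ ℝ) →L[ℝ] ℝ) {g h : Γ →ᵇ ℝ} (hgh : g ≤ h) :
    modulus μ g ≤ modulus μ h := by
  have := modulus_nonneg μ (sub_nonneg.2 hgh)
  rw [map_sub] at this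
  linarith

theorem apply_le_modulus (μ : (Γ →ᵇ ℝ) →L[ℝ] ℝ) {f g : Γ →ᵇ ℝ} (h : ∀ t, |f t| ≤ g t) :
    μ f ≤ modulus μ g :=
  (isLUB_modulus μ fun t => (abs_nonneg _).trans (h t)).1 ⟨f, h, rfl⟩

theorem exists_positive_functional_ge {ι : Type*} (s : Finset ι)
    (m : ι → (Γ →ᵇ ℝ) →ₗ[ℝ] ℝ) (hm : ∀ i g, 0 ≤ g → 0 ≤ m i g) :
    ∃ φ : (Γ →ᵇ ℝ) →ₗ[ℝ] ℝ, (∀ g, 0 ≤ g → 0 ≤ φ g) ∧ ∀ i ∈ s, ∀ g, 0 ≤ g → m i g ≤ φ g := by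
  have hφ : ∀ g, (∑ i ∈ s, m i) g = ∑ i ∈ s, m i g := fun g => LinearMap.sum_apply s m g
  refine ⟨∑ i ∈ s, m i, fun g hg => ?_, fun i hi g hg => ?_⟩
  · rw [hφ]
    exact Finset.sum_nonneg fun i _ => hm i g hg
  · rw [hφ]
    exact Finset.single_le_sum (f := fun i => m i g) (fun i _ => hm i g hg) hi

variable [DiscreteTopology Γ]

/-- The indicator function of a subset of a discrete space. -/
noncomputable def ind (A : Set Γ) : Γ →ᵇ ℝ :=
  BoundedContinuousFunction.indicator A (isClopen_discrete A)

open Classical in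
theorem ind_apply (A : Set Γ) (t : Γ) : ind A t = if t ∈ A then 1 else 0 := by
  change A.indicator 1 t = _
  simp [indicator_apply]

theorem ind_nonneg (A : Set Γ) : 0 ≤ ind A := fun t => by
  classical
  change 0 ≤ ind A t
  rw [ind_apply]; split_ifs <;> simp

theorem ind_mono {A B : Set Γ} (h : A ⊆ B) : ind A ≤ ind B := fun t => by
  classical
  change ind A t ≤ ind B t
  rw [ind_apply, ind_apply]
  split_ifs with h1 h2 <;> first | simp | exact absurd (h h1) h2

theorem ind_union {A B : Set Γ} (h : Disjoint A B) : ind (A ∪ B) = ind A + ind B := by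
  classical
  ext t
  rw [BoundedContinuousFunction.coe_add, Pi.add_apply, ind_apply, ind_apply, ind_apply]
  have hAB : t ∈ A → t ∉ B := fun hA => h.notMem_of_mem_left hA
  by_cases hA : t ∈ A <;> by_cases hB : t ∈ B <;> simp_all

theorem ind_union_le (A B : Set Γ) : ind (A ∪ B) ≤ ind A + ind B := by
  rw [← union_sdiff_self, ind_union disjoint_sdiff_right]
  gcongr
  exact ind_mono sdiff_subset

theorem modulus_ind_union_le (μ : (Γ →ᵇ ℝ) →L[ℝ] ℝ) (A B : Set Γ) :
    modulus μ (ind (A ∪ B)) ≤ modulus μ (ind A) + modulus μ (ind B) := by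
  rw [← map_add]
  exact modulus_mono μ (ind_union_le A B)

theorem modulus_ind_empty (μ : (Γ →ᵇ ℝ) →L[ℝ] ℝ) : modulus μ (ind (∅ : Set Γ)) = 0 := by
  have h : ind (∅ : Set Γ) = 0 := by ext t; classical simp [ind_apply]
  rw [h, map_zero]

variable {X : Type*} [NormedAddCommGroup X] [NormedSpace ℝ X]

theorem modulus_comp_le (Q : (Γ →ᵇ ℝ) →L[ℝ] X) {d : X →L[ℝ] ℝ} (hd : ‖d‖ ≤ 1) (A : Set Γ) :
    modulus (d ∘L Q) (ind A) ≤ ‖Q‖ := by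
  refine (isLUB_modulus _ (ind_nonneg A)).2 ?_
  rintro _ ⟨f, hf, rfl⟩
  have h1 : ‖f‖ ≤ 1 := (BoundedContinuousFunction.norm_le zero_le_one).2 fun t => by
    classical
    have := hf t
    rw [ind_apply] at this
    refine this.trans ?_
    split_ifs <;> simp
  calc d (Q f) ≤ ‖d (Q f)‖ := le_abs_self _
    _ ≤ ‖d‖ * ‖Q f‖ := d.le_opNorm _
    _ ≤ 1 * (‖Q‖ * 1) := by
      gcongr
      exact (Q.le_opNorm f).trans (by gcongr)
    _ = ‖Q‖ := by ring

/-- A separable space contains no separated family indexed by the subsets of an infinite set. -/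
theorem exists_ne_dist_lt_of_separableSpace {X M : Type*} [PseudoMetricSpace X]
    [TopologicalSpace.SeparableSpace X] [Infinite M] (g : Set M → X) {ε : ℝ} (hε : 0 < ε) :
    ∃ S S', S ≠ S' ∧ dist (g S) (g S') < ε := by
  by_contra! hcon
  have hdisj : Pairwise (Function.onFun Disjoint fun S => Metric.ball (g S) (ε / 2)) :=
    fun S S' h => Metric.ball_disjoint_ball (by linarith [hcon S S' h])
  have hc : Countable (Set M) := hdisj.countable_of_isOpen_disjoint
    (fun _ => Metric.isOpen_ball) fun S => ⟨g S, Metric.mem_ball_self (by positivity)⟩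
  obtain ⟨f, hf⟩ := exists_injective_nat (Set M)
  exact Function.cantor_injective _ ((Infinite.natEmbedding M).injective.comp hf)

/-- For an operator from bounded functions to a separable space, the moduli of its compositions with
functionals of norm at most one are uniformly exhaustive. Otherwise Rosenthal's lemma gives disjoint
sets, and functions on them, such that the images of the sums of these functions over any two sets
of indices have distance bounded below. -/
theorem uniformlyExhaustive_modulus [TopologicalSpace.SeparableSpace X] (Q : (Γ →ᵇ ℝ) →L[ℝ] X) :
    UniformlyExhaustive fun (d : {d : X →L[ℝ] ℝ // ‖d‖ ≤ 1}) (A : Set Γ) =>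
      modulus (d.1 ∘L Q) (ind A) := by
  classical
  intro E hE ε hε
  by_contra! hcon
  choose d hd using hcon
  have hf : ∀ n, ∃ f : Γ →ᵇ ℝ, (∀ t, |f t| ≤ ind (E n) t) ∧ ε < (d n).1 (Q f) := fun n => by
    obtain ⟨_, ⟨f, hf, rfl⟩, h⟩ := (lt_isLUB_iff (isLUB_modulus _ (ind_nonneg (E n)))).1 (hd n)
    exact ⟨f, hf, h⟩
  choose f hfE hfε using hf
  have hidx : ∀ {t m n}, t ∈ E m → t ∈ E n → m = n := fun {t m n} hm hn => by
    by_contra h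
    exact disjoint_left.1 (hE h) hm hn
  -- the common extension of the restrictions of `f n` to `E n`
  obtain ⟨F, hF1, hFf⟩ : ∃ F : Γ →ᵇ ℝ, (∀ t, |F t| ≤ 1) ∧ ∀ n, ∀ t ∈ E n, F t = f n t := by
    let F₀ : Γ → ℝ := fun t => if h : ∃ n, t ∈ E n then f h.choose t else 0
    have hF₀ : ∀ n, ∀ t ∈ E n, F₀ t = f n t := fun n t ht => by
      have h : ∃ n, t ∈ E n := ⟨n, ht⟩
      simp only [F₀, dif_pos h]
      rw [hidx h.choose_spec ht]
    have hF₁ : ∀ t, |F₀ t| ≤ 1 := fun t => by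
      by_cases h : ∃ n, t ∈ E n
      · obtain ⟨n, hn⟩ := h
        rw [hF₀ n t hn]
        refine (hfE n t).trans ?_
        rw [ind_apply, if_pos hn]
      · simp [F₀, dif_neg h]
    exact ⟨BoundedContinuousFunction.ofNormedAddCommGroupDiscrete F₀ 1 hF₁, hF₁, hF₀⟩
  let EM : Set ℕ → Set Γ := fun M => ⋃ k ∈ M, E k
  have hEM : ∀ {t n} (M : Set ℕ), t ∈ E n → (t ∈ EM M ↔ n ∈ M) := fun {t n} M ht => by
    simp only [EM, mem_iUnion, exists_prop]
    exact ⟨fun ⟨k, hk, htk⟩ => hidx ht htk ▸ hk, fun h => ⟨n, h, ht⟩⟩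
  obtain ⟨M, hM, hMε⟩ := exists_infinite_forall_diff_lt
    (ν := fun n M => modulus ((d n).1 ∘L Q) (ind (EM M)))
    (fun n A => modulus_nonneg _ (ind_nonneg _))
    (fun n A B h => modulus_mono _ (ind_mono (biUnion_subset_biUnion_left h)))
    (fun n A B h => by
      have hAB : EM (A ∪ B) = EM A ∪ EM B := biUnion_union A B E
      have hdis : Disjoint (EM A) (EM B) := disjoint_left.2 fun t hA hB => by
        obtain ⟨k, hk, htk⟩ := mem_iUnion₂.1 hA
        exact disjoint_left.1 h hk ((hEM B htk).1 hB)
      simp only [hAB, ind_union hdis, map_add, le_refl])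
    (fun n => modulus_comp_le Q (d n).2 _) (half_pos hε)
  have : Infinite M := hM.to_subtype
  let G : Set M → (Γ →ᵇ ℝ) := fun S => F * ind (EM (Subtype.val '' S))
  have hG : ∀ (S : Set M) (k : ℕ), ∀ t ∈ E k,
      G S t = F t * if k ∈ Subtype.val '' S then 1 else 0 := fun S k t ht => by
    change F t * ind (EM _) t = _
    simp only [ind_apply, hEM _ ht]
  have hG0 : ∀ (S : Set M) (t : Γ), (∀ k, t ∉ E k) → G S t = 0 := fun S t ht => by
    change F t * ind (EM _) t = _
    rw [ind_apply, if_neg, mul_zero]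
    simp [EM, ht]
  have hsep : ∀ (S S' : Set M) (n : M), n ∈ S → n ∉ S' → ε / 2 ≤ dist (Q (G S)) (Q (G S')) := by
    intro S S' n hn hn'
    -- outside `E n` the difference `G S - G S'` lives on the other members of the family
    have hR : ∀ t, |(f n - (G S - G S')) t| ≤ ind (EM (M \ {(n : ℕ)})) t := by
      intro t
      change |f n t - (G S t - G S' t)| ≤ _
      by_cases ht : ∃ k, t ∈ E k
      · obtain ⟨k, hk⟩ := ht
        rw [hG S k t hk, hG S' k t hk, ind_apply]
        simp only [hEM _ hk]
        by_cases hkn : k = n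
        · subst hkn
          rw [← hFf _ t hk, if_pos ⟨n, hn, rfl⟩, if_neg, if_neg]
          · simp
          · simp
          · rintro ⟨x, hx, hxn⟩
            exact hn' (Subtype.ext hxn ▸ hx)
        · have h0 : f n t = 0 := by
            have h1 := hfE n t
            rw [ind_apply, if_neg fun h => hkn (hidx hk h)] at h1
            exact abs_nonpos_iff.1 h1
          rw [h0]
          have h1 := hF1 t
          by_cases hkS : k ∈ Subtype.val '' S <;> by_cases hkS' : k ∈ Subtype.val '' S' <;>
            simp only [hkS, hkS', if_true, if_false]
          · simp; split_ifs <;> simp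
          · rw [if_pos ⟨(by obtain ⟨x, -, rfl⟩ := hkS; exact x.2), hkn⟩]
            simpa using h1
          · rw [if_pos ⟨(by obtain ⟨x, -, rfl⟩ := hkS'; exact x.2), hkn⟩]
            simpa using h1
          · simp; split_ifs <;> simp
      · push Not at ht
        have h1 := hfE n t
        rw [ind_apply, if_neg (ht n)] at h1
        rw [hG0 S t ht, hG0 S' t ht, abs_nonpos_iff.1 h1, ind_apply]
        split_ifs <;> simp
    have h1 : (d n).1 (Q (f n - (G S - G S'))) ≤ _ := apply_le_modulus ((d n).1 ∘L Q) hR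
    have h2 := hMε n n.2
    have h3 := hfε n
    rw [map_sub, map_sub, map_sub] at h1
    have h4 : (d n).1 (Q (G S) - Q (G S')) ≤ 1 * ‖Q (G S) - Q (G S')‖ :=
      (le_abs_self _).trans ((d n).1.le_of_opNorm_le (d n).2 _)
    rw [dist_eq_norm]
    linarith
  obtain ⟨S, S', hne, hlt⟩ := exists_ne_dist_lt_of_separableSpace (fun S => Q (G S)) (half_pos hε)
  obtain ⟨n, hn | hn⟩ : ∃ n, (n ∈ S ∧ n ∉ S') ∨ (n ∈ S' ∧ n ∉ S) := by
    by_contra! h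
    exact hne (Subset.antisymm (fun n hn => (h n).1 hn) fun n hn => (h n).2 hn)
  · exact absurd hlt (not_lt.2 (hsep S S' n hn.1 hn.2))
  · rw [dist_comm] at hlt
    exact absurd hlt (not_lt.2 (hsep S' S n hn.1 hn.2))

/-- If a separable space is a linear retract of the space of all bounded functions on a set, then
some positive functional is bounded below on the squares of its unit vectors: otherwise a unit
vector would be small outside a set on which the retraction is small. -/
theorem exists_positive_functional_of_retract [TopologicalSpace.SeparableSpace X]
    (j : X →L[ℝ] (Γ →ᵇ ℝ)) (Q : (Γ →ᵇ ℝ) →L[ℝ] X) (hQj : ∀ x, Q (j x) = x) :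
    ∃ φ : (Γ →ᵇ ℝ) →ₗ[ℝ] ℝ, (∀ g, 0 ≤ g → 0 ≤ φ g) ∧
      ∃ c > 0, ∀ x, ‖x‖ = 1 → c ≤ φ (j x * j x) := by
  classical
  set J : ℝ := ‖j‖ + 1
  have hJ : 0 < J := by positivity
  have hjt : ∀ x t, |j x t| ≤ J * ‖x‖ := fun x t =>
    ((j x).norm_coe_le_norm t).trans ((j.le_opNorm x).trans (by gcongr; simp [J]))
  obtain ⟨s, δ, hδ, hs⟩ := (uniformlyExhaustive_modulus Q).exists_finset_control
    (fun d A B h => modulus_mono _ (ind_mono h)) (fun d => modulus_ind_union_le _)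
    (fun d => modulus_ind_empty _) (show 0 < 1 / (4 * J) by positivity)
  set η : ℝ := 1 / (4 * (‖Q‖ + 1)) with hη
  have hη0 : 0 < η := by positivity
  obtain ⟨φ, hφ, hφs⟩ := exists_positive_functional_ge s
    (fun i : {d : X →L[ℝ] ℝ // ‖d‖ ≤ 1} => modulus (i.1 ∘L Q)) fun i g => modulus_nonneg _
  refine ⟨φ, hφ, η ^ 2 * δ, by positivity, fun x hx => ?_⟩
  let A : Set Γ := {t | η ≤ |j x t|}
  obtain ⟨i, his, hi⟩ : ∃ i ∈ s, δ ≤ modulus (i.1 ∘L Q) (ind A) := by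
    by_contra! hcon
    obtain ⟨d, hd, hdx⟩ := exists_dual_vector'' ℝ x
    have h1 : d (Q (J⁻¹ • (j x * ind A))) ≤ 1 / (4 * J) := by
      refine le_trans (apply_le_modulus (d ∘L Q) fun t => ?_) (hs A hcon ⟨d, hd⟩)
      change |J⁻¹ * (j x t * ind A t)| ≤ ind A t
      have h2 := hjt x t
      have hA0 : 0 ≤ ind A t := ind_nonneg A t
      rw [hx, mul_one] at h2
      rw [abs_mul, abs_mul, abs_of_pos (inv_pos.2 hJ), abs_of_nonneg hA0,
        ← mul_assoc]
      refine mul_le_of_le_one_left hA0 ?_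
      rw [inv_mul_le_iff₀ hJ, mul_one]
      exact h2
    have h2 : d (Q (j x * ind Aᶜ)) ≤ 1 * (‖Q‖ * η) := by
      have h3 : ‖j x * ind Aᶜ‖ ≤ η := (BoundedContinuousFunction.norm_le hη0.le).2 fun t => by
        change |j x t * ind Aᶜ t| ≤ η
        rw [ind_apply]
        split_ifs with h
        · rw [mul_one]
          exact (not_le.1 (show ¬ η ≤ |j x t| from h)).le
        · simp [hη0.le]
      refine (le_abs_self _).trans ((d.le_of_opNorm_le hd _).trans ?_)
      gcongr
      exact (Q.le_opNorm _).trans (by gcongr)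
    have h3 : j x = J • (J⁻¹ • (j x * ind A)) + j x * ind Aᶜ := by
      rw [smul_smul, mul_inv_cancel₀ hJ.ne', one_smul, ← mul_add, ← ind_union disjoint_compl_right,
        union_compl_self]
      ext t
      change _ = j x t * ind univ t
      simp [ind_apply]
    have h4 : d (Q (j x)) = 1 := by rw [hQj, hdx, hx]; rfl
    rw [h3, map_add, map_add, map_smul Q, map_smul d, _root_.smul_eq_mul] at h4
    have h5 := mul_le_mul_of_nonneg_left h1 hJ.le
    have h6 : J * (1 / (4 * J)) = 1 / 4 := by field_simp
    have h7 : (‖Q‖ + 1) * η = 1 / 4 := by rw [hη]; field_simp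
    linarith
  have h1 : φ (η ^ 2 • ind A) ≤ φ (j x * j x) := by
    have h2 : 0 ≤ φ (j x * j x - η ^ 2 • ind A) := hφ _ fun t => by
      change 0 ≤ j x t * j x t - η ^ 2 * ind A t
      rw [ind_apply, ← abs_mul_abs_self, sub_nonneg]
      split_ifs with h
      · have h3 : η ≤ |j x t| := h
        rw [mul_one, pow_two]
        gcongr
      · rw [mul_zero]; positivity
    rw [map_sub] at h2
    linarith
  rw [map_smul, _root_.smul_eq_mul] at h1
  refine le_trans ?_ h1
  gcongr
  exact hi.trans (hφs i his _ (ind_nonneg A))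

/-- A separable normed space which is a linear retract of the space of all bounded functions on a
set is finite-dimensional. -/
theorem finiteDimensional_of_retract [TopologicalSpace.SeparableSpace X]
    (j : X →L[ℝ] (Γ →ᵇ ℝ)) (Q : (Γ →ᵇ ℝ) →L[ℝ] X) (hQj : ∀ x, Q (j x) = x) :
    FiniteDimensional ℝ X := by
  obtain ⟨φ, hφ, c, hc, hunit⟩ := exists_positive_functional_of_retract j Q hQj
  have hnorm : ∀ x : X, ‖x‖ ^ 2 * c ≤ φ (j x * j x) := by
    intro x
    rcases eq_or_ne x 0 with rfl | hx
    · simp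
    have hx' : ‖x‖ ≠ 0 := norm_ne_zero_iff.2 hx
    have h1 := hunit (‖x‖⁻¹ • x) (by rw [norm_smul, norm_inv, norm_norm, inv_mul_cancel₀ hx'])
    rw [map_smul, smul_mul_smul_comm, map_smul, _root_.smul_eq_mul, ← mul_inv,
      ← div_eq_inv_mul, le_div_iff₀ (by positivity)] at h1
    linarith
  refine finiteDimensional_of_sq_le j.toLinearMap (Function.LeftInverse.injective hQj) φ hφ
    (K := ‖j‖ ^ 2 / c) (by positivity) fun x t => ?_
  have h1 := hnorm x
  have h2 : |j x t| ≤ ‖j‖ * ‖x‖ := ((j x).norm_coe_le_norm t).trans (j.le_opNorm x)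
  change (j x t) ^ 2 ≤ ‖j‖ ^ 2 / c * φ (j x * j x)
  calc (j x t) ^ 2 = |j x t| ^ 2 := (sq_abs _).symm
    _ ≤ (‖j‖ * ‖x‖) ^ 2 := by gcongr
    _ = ‖j‖ ^ 2 / c * (‖x‖ ^ 2 * c) := by field_simp
    _ ≤ _ := by gcongr

end Operator

/-! ### Injective Banach spaces are nonseparable -/

/-- An infinite-dimensional injective Banach space is not separable: a separable one embeds into
`ℓ^∞` through a sequence of functionals, and by injectivity it is a retract of `ℓ^∞`. -/
theorem IsInjectiveBanach.not_separableSpace {𝕜 : Type v} [RCLike 𝕜] {X : Type u}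
    [NormedAddCommGroup X] [NormedSpace 𝕜 X] [CompleteSpace X] (hinf : ¬ FiniteDimensional 𝕜 X)
    (hinj : IsInjectiveBanach 𝕜 X) : ¬ TopologicalSpace.SeparableSpace X := by
  intro hsep
  let _ : NormedSpace ℝ X := NormedSpace.restrictScalars ℝ 𝕜 X
  have hsmul : ∀ (r : ℝ) (x : X), r • x = (r : 𝕜) • x := fun r x => by
    rw [← RCLike.algebraMap_eq_ofReal]; rfl
  have : IsScalarTower ℝ 𝕜 X := ⟨fun r k x => by
    rw [hsmul, RCLike.real_smul_eq_coe_mul, mul_smul]⟩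
  have : Nontrivial X := by
    by_contra h
    rw [not_nontrivial_iff_subsingleton] at h
    exact hinf inferInstance
  obtain ⟨x₀, hx₀⟩ := exists_norm_eq X (c := (1 : ℝ)) zero_le_one
  choose f hf hfu using fun n => exists_dual_vector'' 𝕜 (TopologicalSpace.denseSeq X n)
  have hfx : ∀ n x, ‖f n x‖ ≤ ‖x‖ := fun n x => by
    simpa using (f n).le_of_opNorm_le (hf n) x
  -- `ℓ^∞` is realized by sequences in the line of `x₀`, which lives in the universe of `X`
  have hιb : ∀ x n, ‖f n x • x₀‖ ≤ ‖x‖ := fun x n => by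
    rw [norm_smul, hx₀, mul_one]; exact hfx n x
  let ι : X →L[𝕜] (ℕ →ᵇ X) := LinearMap.mkContinuous
    { toFun := fun x => BoundedContinuousFunction.ofNormedAddCommGroupDiscrete
        (fun n => f n x • x₀) ‖x‖ fun n => hιb x n
      map_add' := fun x y => by
        ext n; change f n (x + y) • x₀ = f n x • x₀ + f n y • x₀; rw [map_add, add_smul]
      map_smul' := fun c x => by
        ext n; change f n (c • x) • x₀ = c • f n x • x₀; rw [map_smul, smul_assoc] }
    1 fun x => by
      rw [one_mul]
      exact (BoundedContinuousFunction.norm_le (norm_nonneg x)).2 (hιb x)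
  have hι : ∀ x n, ι x n = f n x • x₀ := fun x n => rfl
  have hanti : AntilipschitzWith 2 ι := ι.antilipschitz_of_bound fun x => by
    rcases eq_or_ne x 0 with rfl | hx
    · simp
    obtain ⟨n, hn⟩ := (TopologicalSpace.denseRange_denseSeq X).exists_dist_lt x
      (show 0 < ‖x‖ / 4 by positivity)
    set y := TopologicalSpace.denseSeq X n
    rw [dist_eq_norm] at hn
    have h1 : ‖f n y‖ = ‖y‖ := by rw [hfu, RCLike.norm_ofReal, abs_norm]
    have h2 := hfx n (x - y)
    rw [map_sub] at h2
    have h3 := norm_sub_norm_le (f n y) (f n x)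
    rw [norm_sub_rev] at h3
    have h4 := norm_sub_norm_le x y
    have h5 : ‖f n x‖ ≤ ‖ι x‖ := by
      have := (ι x).norm_coe_le_norm n
      rwa [hι, norm_smul, hx₀, mul_one] at this
    push_cast
    linarith
  have hcl : IsClosed (range ι) := hanti.isClosed_range ι.uniformContinuous
  obtain ⟨T, hT⟩ := hinj (ℕ →ᵇ X) ι.range hcl
    ((ι.equivRange hanti.injective hcl).symm : ι.range →L[𝕜] X)
  have hTι : ∀ x, T (ι x) = x := fun x =>
    (hT ⟨ι x, x, rfl⟩).trans (ι.equivRange_symm_apply hanti.injective hcl x)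
  -- bounded scalar sequences as real functions on `ℕ × Bool`, by real and imaginary parts
  have hjb : ∀ x (t : ℕ × Bool),
      ‖if t.2 then RCLike.im (f t.1 x) else RCLike.re (f t.1 x)‖ ≤ ‖x‖ := fun x t => by
    split_ifs
    · exact (RCLike.norm_im_le_norm _).trans (hfx _ x)
    · exact (RCLike.norm_re_le_norm _).trans (hfx _ x)
  let j : X →L[ℝ] (ℕ × Bool →ᵇ ℝ) := LinearMap.mkContinuous
    { toFun := fun x => BoundedContinuousFunction.ofNormedAddCommGroupDiscrete
        (fun t => if t.2 then RCLike.im (f t.1 x) else RCLike.re (f t.1 x)) ‖x‖ (hjb x)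
      map_add' := fun x y => by
        ext ⟨n, b⟩
        cases b
        · change RCLike.re (f n (x + y)) = RCLike.re (f n x) + RCLike.re (f n y)
          simp
        · change RCLike.im (f n (x + y)) = RCLike.im (f n x) + RCLike.im (f n y)
          simp
      map_smul' := fun c x => by
        ext ⟨n, b⟩
        cases b
        · change RCLike.re (f n (c • x)) = c * RCLike.re (f n x)
          rw [hsmul, map_smul, _root_.smul_eq_mul, RCLike.re_ofReal_mul]
        · change RCLike.im (f n (c • x)) = c * RCLike.im (f n x)
          rw [hsmul, map_smul, _root_.smul_eq_mul, RCLike.im_ofReal_mul] }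
    1 fun x => by
      rw [one_mul]
      exact (BoundedContinuousFunction.norm_le (norm_nonneg x)).2 (hjb x)
  have hI : ‖(RCLike.I : 𝕜)‖ ≤ 1 := by
    by_cases h : (RCLike.I : 𝕜) = 0
    · simp [h]
    · exact (RCLike.norm_I_of_ne_zero h).le
  have hSb : ∀ (g : ℕ × Bool →ᵇ ℝ) n,
      ‖((g (n, false) : 𝕜) + (g (n, true) : 𝕜) * RCLike.I) • x₀‖ ≤ 2 * ‖g‖ := fun g n => by
    rw [norm_smul, hx₀, mul_one]
    have h1 : ‖(g (n, false) : 𝕜)‖ ≤ ‖g‖ := by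
      rw [RCLike.norm_ofReal]; exact g.norm_coe_le_norm _
    have h2 : ‖(g (n, true) : 𝕜)‖ ≤ ‖g‖ := by
      rw [RCLike.norm_ofReal]; exact g.norm_coe_le_norm _
    have h3 : ‖(g (n, true) : 𝕜) * RCLike.I‖ ≤ ‖(g (n, true) : 𝕜)‖ := by
      rw [norm_mul]
      exact mul_le_of_le_one_right (norm_nonneg _) hI
    have h4 := norm_add_le (g (n, false) : 𝕜) ((g (n, true) : 𝕜) * RCLike.I)
    linarith
  let S : (ℕ × Bool →ᵇ ℝ) →L[ℝ] (ℕ →ᵇ X) := LinearMap.mkContinuous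
    { toFun := fun g => BoundedContinuousFunction.ofNormedAddCommGroupDiscrete
        (fun n => ((g (n, false) : 𝕜) + (g (n, true) : 𝕜) * RCLike.I) • x₀) (2 * ‖g‖) (hSb g)
      map_add' := fun g h => by
        ext n
        change (((g (n, false) + h (n, false) : ℝ) : 𝕜) +
          ((g (n, true) + h (n, true) : ℝ) : 𝕜) * RCLike.I) • x₀ =
          ((g (n, false) : 𝕜) + (g (n, true) : 𝕜) * RCLike.I) • x₀ +
          ((h (n, false) : 𝕜) + (h (n, true) : 𝕜) * RCLike.I) • x₀
        rw [← add_smul]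
        push_cast
        congr 1
        ring
      map_smul' := fun c g => by
        ext n
        change (((c * g (n, false) : ℝ) : 𝕜) + ((c * g (n, true) : ℝ) : 𝕜) * RCLike.I) • x₀ =
          c • ((g (n, false) : 𝕜) + (g (n, true) : 𝕜) * RCLike.I) • x₀
        rw [hsmul, smul_smul]
        push_cast
        congr 1
        ring }
    2 fun g => (BoundedContinuousFunction.norm_le (by positivity)).2 (hSb g)
  have hSj : ∀ x, S (j x) = ι x := fun x => by
    ext n
    change ((RCLike.re (f n x) : 𝕜) + (RCLike.im (f n x) : 𝕜) * RCLike.I) • x₀ = f n x • x₀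
    rw [RCLike.re_add_im]
  have hfin : FiniteDimensional ℝ X := finiteDimensional_of_retract j
    ((T.restrictScalars ℝ) ∘L S) fun x => (congrArg T (hSj x)).trans (hTι x)
  exact hinf (Module.Finite.of_restrictScalars_finite ℝ 𝕜 X)

theorem mainTheorem1 {𝕜 : Type v} [RCLike 𝕜] {X : Type u} [NormedAddCommGroup X]
    [NormedSpace 𝕜 X] [CompleteSpace X] (hinf : ¬ FiniteDimensional 𝕜 X)
    (hinj : IsInjectiveBanach 𝕜 X) :
    ω_ 1 ≤ condRank X ∧
      Set.Icc 1 (ω_ 1) ⊆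
        {α : Ordinal.{u} | ∃ A : Set X, IsClosed A ∧ IsTotallyImperfect A ∧ condRank A = α} := by
  have hsep := hinj.not_separableSpace hinf
  let _ : NormedSpace ℝ X := NormedSpace.restrictScalars ℝ 𝕜 X
  constructor
  · obtain ⟨A, -, -, hA, hne⟩ := exists_iterCondDeriv_eq_empty hsep (omega_pos 1) le_rfl
    exact (condIndex_eq (omega_pos 1) hA hne).symm.trans_le (condIndex_le_condRank A)
  · rintro α ⟨h1, hα⟩
    have h0 : 0 < α := zero_lt_one.trans_le h1
    obtain ⟨A, hAc, hAi, hA, hne⟩ := exists_iterCondDeriv_eq_empty hsep h0 hα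
    exact ⟨A, hAc, hAi, condRank_eq hAc h0 hA hne⟩
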